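/- Let $N\ge 1$ be an integer, $p\ge 2$ and $\alpha\in(0,N)$ real numbers. Consider the lattice graph on $\mathbb Z^N$, where $x\sim y$ iff $\sum_{i}|x_i-y_i|=1$, with graph distance $|x-y|$. For $u,v:\mathbb Z^N\to\mathbb R$ put $$\nabla u\nabla v(x)=\tfrac12\sum_{y\sim x}(u(y)-u(x))(v(y)-v(x)),\qquad |\nabla u|(x)=\sqrt{\nabla u\nabla u(x)},$$ $$\Delta_p u(x)=\tfrac12\sum_{y\sim x}\bigl(|\nabla u|^{p-2}(y)+|\nabla u|^{p-2}(x)\bigr)(u(y)-u(x)).$$ Let $\mu(k)=2N-2\sum_{j=1}^N\cos k_j$ and $$R_\alpha(x,y)=\frac{K_\alpha}{(2\pi)^N}\int_{[0,2\pi]^N}e^{i(x-y)\cdot k}\mu(k)^{-\alpha/2}\,dk,\qquad K_\alpha=\frac1{(2\pi)^N}\int_{[0,2\pi]^N}\mu(k)^{\alpha/2}\,dk,$$ and $(R_\alpha*g)(x)=\sum_{y\in\mathbb Z^N}R_\alpha(x,y)g(y)$. Let $h:\mathbb Z^N\to\mathbb R$ and $f:\mathbb R\to\mathbb R$, and put $F(t)=\int_0^tf(s)\,ds$.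 Let $W^{1,p}(\mathbb Z^N)$ be the completion of the finitely supported functions for the norm $\bigl(\sum_x(|\nabla u|^p+|u|^p)\bigr)^{1/p}$ (a space of functions on $\mathbb Z^N$), and $$H=\Bigl\{u\in W^{1,p}(\mathbb Z^N):\sum_xh(x)|u(x)|^p<\infty\Bigr\},\qquad \|u\|=\Bigl(\sum_x\bigl(|\nabla u|^p+h|u|^p\bigr)(x)\Bigr)^{1/p}.$$ Assume: - $(h_1)$ there is $h_0>0$ with $h(x)\ge h_0$ for all $x\in\mathbb Z^N$; - $(h_3)$ there is $x_0\in\mathbb Z^N$ such that $h(x)\to\infty$ as $|x-x_0|\to\infty$; - $(f_1)$ $f$ is continuous and $f(t)=o(|t|^{p-1})$ as $t\to0$; - $(f_2)$ there are $C>0$ and $\tau>\frac{(N+\alpha)p}{2N}$ with $|f(t)|\le C(1+|t|^{\tau-1})$ for all $t\in\mathbb R$; - $(f_3)$ there is $\theta>p$ with $0\le\theta F(t)\le 2f(t)t$ for all $t\in\mathbb R$; - $(f_4)$ for every $u\in H\setminus\{0\}$ the function $t\mapsto t^{-p}\sum_x(R_\alpha*F(tu))(x)f(tu(x))u(x)$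 is strictly increasing on $(0,\infty)$. Let $$J(u)=\frac1p\sum_x\bigl(|\nabla u|^p+h|u|^p\bigr)(x)-\frac12\sum_x(R_\alpha*F(u))(x)F(u(x)),\qquad u\in H,$$ and $\mathcal M=\{v\in H\setminus\{0\}:\langle J'(v),v\rangle=0\}$, where $J'$ is the Fréchet derivative. Then the equation $$-\Delta_pu+h(x)|u|^{p-2}u=(R_\alpha*F(u))f(u)\quad\text{on }\mathbb Z^N$$ has a ground state solution: there is $u\in H\setminus\{0\}$ with $J'(u)=0$ and $J(u)=\inf_{v\in\mathcal M}J(v)$; moreover $u$ satisfies the equation at every point of $\mathbb Z^N$. -/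

import Mathlib

noncomputable section

namespace LatticeChoquard

/-! ### The lattice graph `ℤ^N` and its difference operators -/

/-- The integer lattice graph `ℤ^N`: `x ∼ y` iff `∑ |x i - y i| = 1`. -/
def latticeGraph (N : ℕ) : SimpleGraph (Fin N → ℤ) where
  Adj x y := ∑ i, |x i - y i| = 1
  symm := ⟨fun x y hxy => by
    simpa only [abs_sub_comm] using hxy⟩
  loopless := ⟨fun x hx => by simp at hx⟩

instance latticeGraph_locallyFinite (N : ℕ) : (latticeGraph N).LocallyFinite := fun x =>
  Set.Finite.fintype <| (Set.finite_Icc (fun i => x i - 1) (fun i => x i + 1)).subset <| by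
    intro y hy
    have hy' : ∑ i, |x i - y i| = 1 := hy
    have key : ∀ i, |x i - y i| ≤ 1 := fun i => by
      rw [← hy']
      exact Finset.single_le_sum (f := fun i => |x i - y i|) (fun j _ => abs_nonneg _)
        (Finset.mem_univ i)
    refine ⟨fun i => ?_, fun i => ?_⟩
    · have := abs_le.1 (key i); simp only; omega
    · have := abs_le.1 (key i); simp only; omega

variable {N : ℕ}

/-- The gradient form `Γ(u,v)(x) = ½ ∑_{y ∼ x} (u y - u x)(v y - v x)`. -/
def gradForm (u v : (Fin N → ℤ) → ℝ) (x : Fin N → ℤ) : ℝ :=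
  (1 / 2) * ∑ y ∈ (latticeGraph N).neighborFinset x, (u y - u x) * (v y - v x)

/-- The length of the gradient `|∇u|(x) = √Γ(u,u)(x)`. -/
def gradLen (u : (Fin N → ℤ) → ℝ) (x : Fin N → ℤ) : ℝ :=
  √(gradForm u u x)

/-- The `p`-Laplacian
`Δ_p u(x) = ½ ∑_{y ∼ x} (|∇u|^{p-2}(y) + |∇u|^{p-2}(x)) (u y - u x)`. -/
def pLaplacian (p : ℝ) (u : (Fin N → ℤ) → ℝ) (x : Fin N → ℤ) : ℝ :=
  (1 / 2) * ∑ y ∈ (latticeGraph N).neighborFinset x,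
    (gradLen u y ^ (p - 2) + gradLen u x ^ (p - 2)) * (u y - u x)

/-! ### The Green's function of the discrete fractional Laplacian -/

/-- `μ(k) = 2N - 2 ∑ cos k_j`. -/
def symbol (k : Fin N → ℝ) : ℝ :=
  2 * N - 2 * ∑ j, Real.cos (k j)

/-- The torus `[0, 2π]^N`. -/
def torus (N : ℕ) : Set (Fin N → ℝ) :=
  Set.Icc (fun _ => 0) (fun _ => 2 * Real.pi)

/-- The fractional degree `K_α = (2π)^{-N} ∫ μ(k)^{α/2} dk`. -/
def fracDegree (N : ℕ) (α : ℝ) : ℝ :=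
  1 / (2 * Real.pi) ^ N * ∫ k in torus N, symbol k ^ (α / 2)

/-- The Green's function
`R_α(x,y) = K_α (2π)^{-N} ∫ e^{i (x-y)·k} μ(k)^{-α/2} dk`. The integral is a real number by the
symmetry `k ↦ 2π - k`, so taking the real part only changes the type. -/
def green (α : ℝ) (x y : Fin N → ℤ) : ℝ :=
  (((fracDegree N α / (2 * Real.pi) ^ N : ℝ) : ℂ) *
    ∫ k in torus N,
      Complex.exp (Complex.I * ((∑ j, ((x j - y j : ℤ) : ℝ) * k j : ℝ) : ℂ)) *
        ((symbol k ^ (-(α / 2)) : ℝ) : ℂ)).re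

/-- The convolution `(R_α * g)(x) = ∑_y R_α(x,y) g(y)`. -/
def greenConv (α : ℝ) (g : (Fin N → ℤ) → ℝ) (x : Fin N → ℤ) : ℝ :=
  ∑' y, green α x y * g y

/-! ### The spaces `W^{1,p}(ℤ^N)` and `H` -/

/-- The density `|∇u|^p + h |u|^p`. -/
def energyDensity (p : ℝ) (h u : (Fin N → ℤ) → ℝ) (x : Fin N → ℤ) : ℝ :=
  gradLen u x ^ p + h x * |u x| ^ p

/-- `(∑_x (|∇u|^p + h |u|^p))^{1/p}`. -/
def energyNorm (p : ℝ) (h u : (Fin N → ℤ) → ℝ) : ℝ :=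
  (∑' x, energyDensity p h u x) ^ (1 / p)

/-- Membership in `W^{1,p}(ℤ^N)`, the completion of the finitely supported functions for the norm
`(∑ (|∇u|^p + |u|^p))^{1/p}`, realized as a space of functions: `u` has finite norm and is a limit
in this norm of finitely supported functions. -/
def MemW1p (p : ℝ) (u : (Fin N → ℤ) → ℝ) : Prop :=
  Summable (energyDensity p (fun _ => 1) u) ∧
    ∀ ε > 0, ∃ v : (Fin N → ℤ) → ℝ, (Function.support v).Finite ∧
      energyNorm p (fun _ => 1) (u - v) < ε

/-- The potential is bounded below by a positive constant. -/
def BoundedBelow (h : (Fin N → ℤ) → ℝ) : Prop :=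
  ∃ h₀ : ℝ, 0 < h₀ ∧ ∀ x, h₀ ≤ h x

/-! Auxiliary facts: the energy norm is a norm. -/

theorem gradForm_self_nonneg (u : (Fin N → ℤ) → ℝ) (x : Fin N → ℤ) : 0 ≤ gradForm u u x :=
  mul_nonneg (by norm_num) (Finset.sum_nonneg fun _ _ => mul_self_nonneg _)

theorem gradLen_nonneg (u : (Fin N → ℤ) → ℝ) (x : Fin N → ℤ) : 0 ≤ gradLen u x :=
  Real.sqrt_nonneg _

theorem gradLen_add_le (u v : (Fin N → ℤ) → ℝ) (x : Fin N → ℤ) :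
    gradLen (u + v) x ≤ gradLen u x + gradLen v x := by
  have hcs : gradForm u v x ≤ gradLen u x * gradLen v x := by
    unfold gradLen
    rw [← Real.sqrt_mul (gradForm_self_nonneg u x)]
    apply Real.le_sqrt_of_sq_le
    have := Finset.sum_mul_sq_le_sq_mul_sq ((latticeGraph N).neighborFinset x)
      (fun y => u y - u x) (fun y => v y - v x)
    simp only [gradForm, ← pow_two]
    nlinarith [this]
  have hexp : gradForm (u + v) (u + v) x
      = gradForm u u x + 2 * gradForm u v x + gradForm v v x := by
    simp only [gradForm, Finset.mul_sum, ← Finset.sum_add_distrib]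
    refine Finset.sum_congr rfl fun y _ => ?_
    simp only [Pi.add_apply]
    ring
  have hu : gradLen u x ^ 2 = gradForm u u x := Real.sq_sqrt (gradForm_self_nonneg u x)
  have hv : gradLen v x ^ 2 = gradForm v v x := Real.sq_sqrt (gradForm_self_nonneg v x)
  refine Real.sqrt_le_iff.2 ⟨add_nonneg (gradLen_nonneg u x) (gradLen_nonneg v x), ?_⟩
  rw [hexp]
  nlinarith

theorem gradLen_smul (c : ℝ) (u : (Fin N → ℤ) → ℝ) (x : Fin N → ℤ) :
    gradLen (c • u) x = |c| * gradLen u x := by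
  have : gradForm (c • u) (c • u) x = c ^ 2 * gradForm u u x := by
    simp only [gradForm, Finset.mul_sum]
    refine Finset.sum_congr rfl fun y _ => ?_
    simp only [Pi.smul_apply, smul_eq_mul]
    ring
  rw [gradLen, this, Real.sqrt_mul (sq_nonneg c), Real.sqrt_sq_eq_abs, gradLen]

theorem energyDensity_nonneg (p : ℝ) {h : (Fin N → ℤ) → ℝ} (hh : ∀ x, 0 ≤ h x)
    (u : (Fin N → ℤ) → ℝ) (x : Fin N → ℤ) : 0 ≤ energyDensity p h u x :=
  add_nonneg (Real.rpow_nonneg (gradLen_nonneg u x) p)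
    (mul_nonneg (hh x) (Real.rpow_nonneg (abs_nonneg _) p))

theorem energyDensity_zero {p : ℝ} (hp : 2 ≤ p) (h : (Fin N → ℤ) → ℝ) :
    energyDensity p h (0 : (Fin N → ℤ) → ℝ) = 0 := by
  have hp0 : p ≠ 0 := by linarith
  funext x
  simp [energyDensity, gradLen, gradForm, Real.zero_rpow hp0]

theorem energyDensity_smul (p : ℝ) (h : (Fin N → ℤ) → ℝ) (c : ℝ) (u : (Fin N → ℤ) → ℝ)
    (x : Fin N → ℤ) : energyDensity p h (c • u) x = |c| ^ p * energyDensity p h u x := by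
  simp only [energyDensity, gradLen_smul, Pi.smul_apply, smul_eq_mul, abs_mul]
  rw [Real.mul_rpow (abs_nonneg _) (gradLen_nonneg _ _), Real.mul_rpow (abs_nonneg _) (abs_nonneg _)]
  ring

theorem energyDensity_add_le {p : ℝ} (hp : 2 ≤ p) {h : (Fin N → ℤ) → ℝ} (hh : ∀ x, 0 ≤ h x)
    (u v : (Fin N → ℤ) → ℝ) (x : Fin N → ℤ) :
    energyDensity p h (u + v) x ≤
      (energyDensity p h u x ^ (1 / p) + energyDensity p h v x ^ (1 / p)) ^ p := by
  have hp0 : 0 < p := by linarith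
  have hw : ∀ t : ℝ, 0 ≤ t → h x * t ^ p = (h x ^ (1 / p) * t) ^ p := fun t ht => by
    rw [Real.mul_rpow (Real.rpow_nonneg (hh x) _) ht, ← Real.rpow_mul (hh x),
      one_div_mul_cancel hp0.ne', Real.rpow_one]
  have hc : 0 ≤ h x ^ (1 / p) := Real.rpow_nonneg (hh x) _
  have key := Real.Lp_add_le_of_nonneg (s := (Finset.univ : Finset (Fin 2))) (p := p)
    (f := ![gradLen u x, h x ^ (1 / p) * |u x|]) (g := ![gradLen v x, h x ^ (1 / p) * |v x|])
    (by linarith)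
    (by
      intro i _
      fin_cases i
      · exact gradLen_nonneg u x
      · exact mul_nonneg hc (abs_nonneg _))
    (by
      intro i _
      fin_cases i
      · exact gradLen_nonneg v x
      · exact mul_nonneg hc (abs_nonneg _))
  simp only [Fin.sum_univ_two, Matrix.cons_val_zero, Matrix.cons_val_one] at key
  rw [← hw _ (abs_nonneg _), ← hw _ (abs_nonneg _), ← mul_add,
    ← hw _ (add_nonneg (abs_nonneg _) (abs_nonneg _))] at key
  have hle : energyDensity p h (u + v) x ≤
      (gradLen u x + gradLen v x) ^ p + h x * (|u x| + |v x|) ^ p := by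
    refine add_le_add ?_ (mul_le_mul_of_nonneg_left ?_ (hh x))
    · exact Real.rpow_le_rpow (gradLen_nonneg _ _) (gradLen_add_le u v x) hp0.le
    · exact Real.rpow_le_rpow (abs_nonneg _) (abs_add_le _ _) hp0.le
  refine hle.trans ?_
  have hnn : 0 ≤ (gradLen u x + gradLen v x) ^ p + h x * (|u x| + |v x|) ^ p :=
    (energyDensity_nonneg p hh (u + v) x).trans hle
  have h2 := Real.rpow_le_rpow (Real.rpow_nonneg hnn _) key hp0.le
  rwa [← Real.rpow_mul hnn, one_div_mul_cancel hp0.ne', Real.rpow_one] at h2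

theorem energy_add {p : ℝ} (hp : 2 ≤ p) {h : (Fin N → ℤ) → ℝ} (hh : ∀ x, 0 ≤ h x)
    {u v : (Fin N → ℤ) → ℝ} (hu : Summable (energyDensity p h u))
    (hv : Summable (energyDensity p h v)) :
    Summable (energyDensity p h (u + v)) ∧
      energyNorm p h (u + v) ≤ energyNorm p h u + energyNorm p h v := by
  have hp0 : 0 < p := by linarith
  have hnn := fun w x => energyDensity_nonneg (N := N) p hh w x
  have hpow : ∀ w x, (energyDensity p h w x ^ (1 / p)) ^ p = energyDensity p h w x :=
    fun w x => by rw [← Real.rpow_mul (hnn w x), one_div_mul_cancel hp0.ne', Real.rpow_one]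
  obtain ⟨h1, h2⟩ := Real.Lp_add_le_tsum_of_nonneg (p := p) (by linarith)
    (fun x => Real.rpow_nonneg (hnn u x) (1 / p)) (fun x => Real.rpow_nonneg (hnn v x) (1 / p))
    (by simpa only [hpow] using hu) (by simpa only [hpow] using hv)
  have hle := energyDensity_add_le hp hh u v
  have hs : Summable (energyDensity p h (u + v)) := Summable.of_nonneg_of_le (hnn _) hle h1
  refine ⟨hs, ?_⟩
  simp only [hpow] at h2
  refine le_trans ?_ h2
  exact Real.rpow_le_rpow (tsum_nonneg (hnn _)) (hs.tsum_le_tsum hle h1)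
    (by positivity)

theorem energyNorm_smul {p : ℝ} (hp : 2 ≤ p) {h : (Fin N → ℤ) → ℝ} (hh : ∀ x, 0 ≤ h x)
    (c : ℝ) (u : (Fin N → ℤ) → ℝ) : energyNorm p h (c • u) = |c| * energyNorm p h u := by
  have hp0 : 0 < p := by linarith
  simp only [energyNorm, energyDensity_smul, tsum_mul_left]
  rw [Real.mul_rpow (Real.rpow_nonneg (abs_nonneg _) _)
    (tsum_nonneg (energyDensity_nonneg p hh u)), ← Real.rpow_mul (abs_nonneg _),
    mul_one_div_cancel hp0.ne', Real.rpow_one]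

theorem summable_energyDensity_smul {p : ℝ} {h : (Fin N → ℤ) → ℝ}
    (c : ℝ) {u : (Fin N → ℤ) → ℝ} (hu : Summable (energyDensity p h u)) :
    Summable (energyDensity p h (c • u)) :=
  (hu.mul_left (|c| ^ p)).congr fun x => (energyDensity_smul p h c u x).symm

/-- A finitely supported function has finite energy. -/
theorem summable_energyDensity_of_finite {p : ℝ} (hp : 2 ≤ p) (h : (Fin N → ℤ) → ℝ)
    {v : (Fin N → ℤ) → ℝ} (hv : (Function.support v).Finite) :
    Summable (energyDensity p h v) := by
  have hp0 : p ≠ 0 := by linarith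
  have hfin : (Function.support v ∪
      ⋃ y ∈ Function.support v, (latticeGraph N).neighborSet y).Finite :=
    hv.union (hv.biUnion fun y _ => Set.toFinite _)
  refine summable_of_hasFiniteSupport (hfin.subset fun x hx => ?_)
  by_contra hcon
  simp only [Set.mem_union, Set.mem_iUnion, not_or, not_exists] at hcon
  have hx0 : v x = 0 := by simpa using hcon.1
  have hy0 : ∀ y ∈ (latticeGraph N).neighborFinset x, v y = 0 := fun y hy => by
    by_contra hne
    exact hcon.2 y hne ((latticeGraph N).symm.symm _ _
      ((SimpleGraph.mem_neighborFinset _ _ _).1 hy))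
  apply hx
  have : gradForm v v x = 0 := by
    unfold gradForm
    rw [Finset.sum_eq_zero fun y hy => by rw [hy0 y hy, hx0]; ring, mul_zero]
  simp [energyDensity, gradLen, this, hx0, Real.zero_rpow hp0]

theorem summable_energyDensity_iff {p : ℝ} {h : (Fin N → ℤ) → ℝ} (hh : ∀ x, 0 ≤ h x)
    (u : (Fin N → ℤ) → ℝ) :
    Summable (energyDensity p h u) ↔
      Summable (fun x => gradLen u x ^ p) ∧ Summable (fun x => h x * |u x| ^ p) := by
  refine ⟨fun hs => ⟨?_, ?_⟩, fun hs => hs.1.add hs.2⟩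
  · exact Summable.of_nonneg_of_le (fun x => Real.rpow_nonneg (gradLen_nonneg u x) p)
      (fun x => le_add_of_nonneg_right (mul_nonneg (hh x) (Real.rpow_nonneg (abs_nonneg _) p))) hs
  · exact Summable.of_nonneg_of_le
      (fun x => mul_nonneg (hh x) (Real.rpow_nonneg (abs_nonneg _) p))
      (fun x => le_add_of_nonneg_left (Real.rpow_nonneg (gradLen_nonneg u x) p)) hs

theorem BoundedBelow.nonneg {h : (Fin N → ℤ) → ℝ} (hh : BoundedBelow h) (x : Fin N → ℤ) :
    0 ≤ h x := by
  obtain ⟨h₀, h0, hle⟩ := hh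
  exact h0.le.trans (hle x)

theorem MemW1p.add {p : ℝ} (hp : 2 ≤ p) {u v : (Fin N → ℤ) → ℝ} (hu : MemW1p p u)
    (hv : MemW1p p v) : MemW1p p (u + v) := by
  have h1 : ∀ x : Fin N → ℤ, (0 : ℝ) ≤ (fun _ => (1 : ℝ)) x := fun _ => zero_le_one
  have hsub : ∀ {a b : (Fin N → ℤ) → ℝ}, Summable (energyDensity p (fun _ => 1) a) →
      (Function.support b).Finite → Summable (energyDensity p (fun _ => 1) (a - b)) := by
    intro a b ha hb
    have := (energy_add hp h1 ha (summable_energyDensity_smul (-1)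
      (summable_energyDensity_of_finite hp (fun _ => 1) hb))).1
    rwa [neg_one_smul, ← sub_eq_add_neg] at this
  refine ⟨(energy_add hp h1 hu.1 hv.1).1, fun ε hε => ?_⟩
  obtain ⟨a, ha, hua⟩ := hu.2 (ε / 2) (by linarith)
  obtain ⟨b, hb, hvb⟩ := hv.2 (ε / 2) (by linarith)
  refine ⟨a + b, (ha.union hb).subset (Function.support_add a b), ?_⟩
  have := (energy_add hp h1 (hsub hu.1 ha) (hsub hv.1 hb)).2
  rw [add_sub_add_comm]
  linarith

theorem MemW1p.smul {p : ℝ} (hp : 2 ≤ p) (c : ℝ) {u : (Fin N → ℤ) → ℝ} (hu : MemW1p p u) :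
    MemW1p p (c • u) := by
  refine ⟨summable_energyDensity_smul c hu.1, fun ε hε => ?_⟩
  obtain ⟨a, ha, hua⟩ := hu.2 (ε / (|c| + 1)) (by positivity)
  refine ⟨c • a, ha.subset (Function.support_const_smul_subset c a), ?_⟩
  rw [← smul_sub, energyNorm_smul hp (fun _ => zero_le_one)]
  rw [lt_div_iff₀ (by positivity)] at hua
  have : 0 ≤ energyNorm p (fun _ => 1) (u - a) :=
    Real.rpow_nonneg (tsum_nonneg (energyDensity_nonneg p (fun _ => zero_le_one) _)) _
  nlinarith

theorem MemW1p.zero {p : ℝ} (hp : 2 ≤ p) : MemW1p p (0 : (Fin N → ℤ) → ℝ) := by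
  have hp0 : 1 / p ≠ 0 := by
    have : 0 < p := by linarith
    positivity
  refine ⟨by rw [energyDensity_zero hp]; exact summable_zero, fun ε hε => ⟨0, by simp, ?_⟩⟩
  rw [sub_zero, energyNorm, energyDensity_zero hp]
  simp only [Pi.zero_apply, tsum_zero, Real.zero_rpow hp0]
  exact hε

/-- `H = {u ∈ W^{1,p}(ℤ^N) : ∑ h |u|^p < ∞}` as a linear space of functions. -/
def HSubmodule (p : ℝ) (h : (Fin N → ℤ) → ℝ) (hp : 2 ≤ p) (hh : BoundedBelow h) :
    Submodule ℝ ((Fin N → ℤ) → ℝ) where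
  carrier := {u | MemW1p p u ∧ Summable fun x => h x * |u x| ^ p}
  zero_mem' := ⟨MemW1p.zero hp, by
    have hp0 : p ≠ 0 := by linarith
    simp [Real.zero_rpow hp0]⟩
  add_mem' := fun {u v} hu hv => by
    have hgrad : ∀ {w : (Fin N → ℤ) → ℝ}, MemW1p p w → Summable fun x => gradLen w x ^ p :=
      fun hw => ((summable_energyDensity_iff (fun _ => zero_le_one) _).1 hw.1).1
    exact ⟨hu.1.add hp hv.1, ((summable_energyDensity_iff hh.nonneg _).1
      (energy_add hp hh.nonneg ((summable_energyDensity_iff hh.nonneg _).2 ⟨hgrad hu.1, hu.2⟩)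
        ((summable_energyDensity_iff hh.nonneg _).2 ⟨hgrad hv.1, hv.2⟩)).1).2⟩
  smul_mem' := fun c u hu => ⟨hu.1.smul hp c, by
    refine (hu.2.mul_left (|c| ^ p)).congr fun x => ?_
    rw [Pi.smul_apply, smul_eq_mul, abs_mul, Real.mul_rpow (abs_nonneg _) (abs_nonneg _)]
    ring⟩

/-- The space `H`, to be equipped with the norm `(∑ (|∇u|^p + h |u|^p))^{1/p}`. -/
def HSpace (p : ℝ) (h : (Fin N → ℤ) → ℝ) (hp : 2 ≤ p) (hh : BoundedBelow h) : Type :=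
  ↥(HSubmodule p h hp hh)

variable {p : ℝ} {h : (Fin N → ℤ) → ℝ} {hp : 2 ≤ p} {hh : BoundedBelow h}

instance : AddCommGroup (HSpace p h hp hh) :=
  inferInstanceAs (AddCommGroup ↥(HSubmodule p h hp hh))

instance : Module ℝ (HSpace p h hp hh) :=
  inferInstanceAs (Module ℝ ↥(HSubmodule p h hp hh))

instance : CoeFun (HSpace p h hp hh) (fun _ => (Fin N → ℤ) → ℝ) :=
  ⟨fun u => Subtype.val (p := (· ∈ HSubmodule p h hp hh)) u⟩

instance : Norm (HSpace p h hp hh) :=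
  ⟨fun u => energyNorm p h u⟩

theorem HSpace.summable (u : HSpace p h hp hh) : Summable (energyDensity p h u) :=
  (summable_energyDensity_iff hh.nonneg _).2
    ⟨((summable_energyDensity_iff (fun _ => zero_le_one) _).1 u.2.1.1).1, u.2.2⟩

theorem HSpace.normCore : NormedSpace.Core ℝ (HSpace p h hp hh) where
  norm_nonneg u := Real.rpow_nonneg (tsum_nonneg (energyDensity_nonneg p hh.nonneg _)) _
  norm_smul c u := energyNorm_smul hp hh.nonneg c u
  norm_triangle u v := (energy_add hp hh.nonneg u.summable v.summable).2
  norm_eq_zero_iff u := by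
    have hp0 : 0 < p := by linarith
    have hp1 : 1 / p ≠ 0 := by positivity
    have hnn := energyDensity_nonneg p hh.nonneg (u : (Fin N → ℤ) → ℝ)
    constructor
    · intro hu
      have hu' : (∑' x, energyDensity p h u x) ^ (1 / p) = 0 := hu
      rw [Real.rpow_eq_zero (tsum_nonneg hnn) hp1] at hu'
      have hz := (hasSum_zero_iff_of_nonneg hnn).1 (hu' ▸ u.summable.hasSum)
      refine Subtype.ext (funext fun x => ?_)
      have hx : energyDensity p h u x = 0 := congrFun hz x
      have hpos : 0 < h x := by
        obtain ⟨h₀, h0, hle⟩ := hh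
        exact h0.trans_le (hle x)
      have h1 : 0 ≤ gradLen (u : (Fin N → ℤ) → ℝ) x ^ p := Real.rpow_nonneg (gradLen_nonneg _ x) p
      by_contra hne
      have : 0 < h x * |u x| ^ p := mul_pos hpos (Real.rpow_pos_of_pos (abs_pos.2 hne) p)
      unfold energyDensity at hx
      linarith
    · rintro rfl
      have : energyNorm p h (0 : (Fin N → ℤ) → ℝ) = 0 := by
        rw [energyNorm, energyDensity_zero hp]
        simp only [Pi.zero_apply, tsum_zero, Real.zero_rpow hp1]
      exact this

instance : NormedAddCommGroup (HSpace p h hp hh) :=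
  NormedAddCommGroup.ofCore HSpace.normCore

instance : NormedSpace ℝ (HSpace p h hp hh) :=
  NormedSpace.ofCore HSpace.normCore

/-! ### The energy functional, the Nehari manifold and ground states -/

/-- `F(t) = ∫_0^t f(s) ds`. -/
def primitive (f : ℝ → ℝ) (t : ℝ) : ℝ :=
  ∫ s in (0 : ℝ)..t, f s

/-- The energy functional
`J(u) = (1/p) ∑ (|∇u|^p + h |u|^p) - ½ ∑ (R_α * F(u)) F(u)` on `H`. -/
def energy (α : ℝ) (f : ℝ → ℝ) (u : HSpace p h hp hh) : ℝ :=
  (1 / p) * ∑' x, energyDensity p h u x -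
    (1 / 2) * ∑' x, greenConv α (fun y => primitive f (u y)) x * primitive f (u x)

/-- The Nehari manifold `{v ∈ H ∖ {0} : ⟨J'(v), v⟩ = 0}`, with `J'` the Fréchet derivative. -/
def nehari (α : ℝ) (f : ℝ → ℝ) : Set (HSpace p h hp hh) :=
  {v | v ≠ 0 ∧ fderiv ℝ (energy α f) v v = 0}

/-- `u` is a ground state: a nontrivial critical point of `J` with
`J(u) = inf` of `J` over the Nehari manifold. -/
def IsGroundState (α : ℝ) (f : ℝ → ℝ) (u : HSpace p h hp hh) : Prop :=
  u ≠ 0 ∧ HasFDerivAt (energy α f) (0 : HSpace p h hp hh →L[ℝ] ℝ) u ∧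
    IsGLB (energy α f '' (nehari α f : Set (HSpace p h hp hh))) (energy α f u)

/-- `u` solves `-Δ_p u + h |u|^{p-2} u = (R_α * F(u)) f(u)` at every point of `ℤ^N`. -/
def SolvesEquation (p α : ℝ) (h : (Fin N → ℤ) → ℝ) (f : ℝ → ℝ) (u : (Fin N → ℤ) → ℝ) : Prop :=
  ∀ x, -pLaplacian p u x + h x * |u x| ^ (p - 2) * u x =
    greenConv α (fun y => primitive f (u y)) x * f (u x)

end LatticeChoquard

end

/-
On the Nehari manifold `J` is the maximum along each ray, because by `(f_4)` the derivative of `J`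
along a ray, divided by `t ^ (p - 1)`, is strictly decreasing. For a minimizing sequence only the
directions `v n / ‖v n‖` matter: since `h → ∞`, the unit ball of `H` has compact image in `ℓ^p`, so
they converge in `ℓ^p` to some `w` in the unit ball. The nonlocal term `I` is continuous on `ℓ^p`,
hence `s^p / p - I (s w) ≤ inf J` for all `s ≥ 0`; this forces `w ≠ 0`, and rescaling `w` to the
Nehari manifold gives a minimizer. If `J' u ≠ 0` at a minimizer `u`, moving slightly in a direction
of descent and projecting back along rays would lower `J`.

Since functions in `ℓ^p` are bounded, `f(t) = O(|t|^{p-1})` at `0` gives `|F(u)| ≤ C |u|^p` for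
every such function `u`. Thus `F(u) ∈ ℓ^1`, where the bounded kernel `R_α` defines a bilinear
form, and this replaces the Hardy-Littlewood-Sobolev inequality. The kernel is nonnegative: `μ`
is a multiple of `1 - c` with `c` the mean of the cosines, `(1 - c)^{-α/2}` is a power series in
`c` with nonnegative coefficients, and the powers of `c` have nonnegative Fourier coefficients.
-/

noncomputable section

namespace LatticeChoquard

open MeasureTheory Set Filter Topology

/-! ### Positivity of the Green's function -/

section Green

variable {N : ℕ} {α : ℝ}

theorem continuous_symbol : Continuous (symbol : (Fin N → ℝ) → ℝ) := by
  unfold symbol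
  fun_prop

theorem symbol_eq_sum_sin_sq (k : Fin N → ℝ) : symbol k = 4 * ∑ j, Real.sin (k j / 2) ^ 2 := by
  simp only [symbol, Real.sin_sq_eq_half_sub, mul_div_cancel₀ _ (two_ne_zero' ℝ),
    Finset.sum_sub_distrib, ← Finset.sum_div, Finset.sum_const, Finset.card_univ, Fintype.card_fin,
    nsmul_eq_mul]
  ring

theorem symbol_nonneg (k : Fin N → ℝ) : 0 ≤ symbol k := by
  rw [symbol_eq_sum_sin_sq]
  positivity

theorem isCompact_torus (N : ℕ) : IsCompact (torus N) :=
  isCompact_Icc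

theorem torus_ae_eq_pi_Ioo (N : ℕ) :
    torus N =ᵐ[volume] univ.pi fun _ : Fin N => Ioo 0 (2 * Real.pi) :=
  Measure.univ_pi_Ioo_ae_eq_Icc.symm

theorem ae_torus_mem_Ioo (N : ℕ) :
    ∀ᵐ k ∂volume.restrict (torus N), ∀ j, k j ∈ Ioo 0 (2 * Real.pi) := by
  rw [Measure.restrict_congr_set (torus_ae_eq_pi_Ioo N)]
  exact (ae_restrict_mem (MeasurableSet.univ_pi fun _ => measurableSet_Ioo)).mono
    fun k hk j => hk j (mem_univ j)

theorem sin_half_pos {t : ℝ} (ht : t ∈ Ioo 0 (2 * Real.pi)) : 0 < Real.sin (t / 2) :=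
  Real.sin_pos_of_pos_of_lt_pi (by linarith [ht.1]) (by linarith [ht.2])

theorem min_div_pi_le_sin_half {t : ℝ} (ht : t ∈ Ioo 0 (2 * Real.pi)) :
    min t (2 * Real.pi - t) / Real.pi ≤ Real.sin (t / 2) := by
  have jordan : ∀ s, 0 ≤ s → s ≤ Real.pi → s / Real.pi ≤ Real.sin (s / 2) := fun s hs hsπ => by
    refine le_trans (le_of_eq ?_) (Real.mul_le_sin (x := s / 2) (by linarith) (by linarith))
    field_simp
  rcases le_total t Real.pi with h | h
  · rw [min_eq_left (by linarith)]
    exact jordan t ht.1.le h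
  · rw [min_eq_right (by linarith), ← Real.sin_pi_sub, show Real.pi - t / 2 =
      (2 * Real.pi - t) / 2 by ring]
    exact jordan _ (by linarith [ht.2]) (by linarith)

theorem sin_half_rpow_neg_le {a t : ℝ} (ha : 0 ≤ a) (ht : t ∈ Ioo 0 (2 * Real.pi)) :
    Real.sin (t / 2) ^ (-a) ≤ Real.pi⁻¹ ^ (-a) * (t ^ (-a) + (2 * Real.pi - t) ^ (-a)) := by
  have ht' : 0 < 2 * Real.pi - t := sub_pos.2 ht.2
  have hmin : 0 < min t (2 * Real.pi - t) := lt_min ht.1 ht'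
  calc Real.sin (t / 2) ^ (-a) ≤ (min t (2 * Real.pi - t) / Real.pi) ^ (-a) :=
        Real.rpow_le_rpow_of_nonpos (by positivity) (min_div_pi_le_sin_half ht) (by linarith)
    _ = Real.pi⁻¹ ^ (-a) * min t (2 * Real.pi - t) ^ (-a) := by
        rw [div_eq_inv_mul, Real.mul_rpow (by positivity) hmin.le]
    _ ≤ _ := by
        refine mul_le_mul_of_nonneg_left ?_ (by positivity)
        have h₁ := Real.rpow_nonneg ht.1.le (-a)
        have h₂ := Real.rpow_nonneg ht'.le (-a)
        rcases min_choice t (2 * Real.pi - t) with h | h <;> rw [h] <;> linarith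

theorem integrableOn_sin_half_rpow_neg {a : ℝ} (ha : 0 ≤ a) (ha1 : a < 1) :
    IntegrableOn (fun t : ℝ => Real.sin (t / 2) ^ (-a)) (Ioo 0 (2 * Real.pi)) := by
  have hle : 0 ≤ 2 * Real.pi := by positivity
  have hI := intervalIntegral.intervalIntegrable_rpow' (a := 0) (b := 2 * Real.pi) (r := -a)
    (by linarith)
  have hI' := (hI.comp_sub_left (2 * Real.pi)).symm
  rw [sub_self, sub_zero] at hI'
  rw [intervalIntegrable_iff_integrableOn_Ioo_of_le hle] at hI hI'
  refine Integrable.mono' ((hI.add hI').const_mul (Real.pi⁻¹ ^ (-a)))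
    (Measurable.aestronglyMeasurable (by fun_prop)) ?_
  filter_upwards [ae_restrict_mem measurableSet_Ioo] with t ht
  rw [Real.norm_of_nonneg (Real.rpow_nonneg (sin_half_pos ht).le _)]
  exact sin_half_rpow_neg_le ha ht

theorem prod_sin_le_symbol (hN : 0 < N) {k : Fin N → ℝ} (hk : ∀ j, k j ∈ Ioo 0 (2 * Real.pi)) :
    ∏ j, Real.sin (k j / 2) ^ (2 / N : ℝ) ≤ symbol k := by
  have hN' : (1 : ℝ) ≤ N := by exact_mod_cast hN
  calc ∏ j, Real.sin (k j / 2) ^ (2 / N : ℝ)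
      = ∏ j, (Real.sin (k j / 2) ^ 2) ^ (1 / N : ℝ) := by
        refine Finset.prod_congr rfl fun j _ => ?_
        rw [← Real.rpow_natCast, ← Real.rpow_mul (sin_half_pos (hk j)).le, Nat.cast_two,
          mul_one_div]
    _ ≤ ∑ j, (1 / N : ℝ) * Real.sin (k j / 2) ^ 2 :=
        Real.geom_mean_le_arith_mean_weighted _ _ _ (fun _ _ => by positivity)
          (by simp; field_simp) fun _ _ => by positivity
    _ = (1 / N) * ∑ j, Real.sin (k j / 2) ^ 2 := (Finset.mul_sum _ _ _).symm
    _ ≤ 4 * ∑ j, Real.sin (k j / 2) ^ 2 := by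
        refine mul_le_mul_of_nonneg_right ?_ (by positivity)
        rw [div_le_iff₀ (by positivity)]
        linarith
    _ = symbol k := (symbol_eq_sum_sin_sq k).symm

-- By AM-GM the singularity of `symbol` is dominated by a product of one-dimensional ones.
theorem integrableOn_symbol_rpow_neg (hα : 0 < α) (hαN : α < N) :
    IntegrableOn (fun k : Fin N → ℝ => symbol k ^ (-(α / 2))) (torus N) := by
  have hN' : (0 : ℝ) < N := hα.trans hαN
  have hN : 0 < N := by exact_mod_cast hN'
  have hprod : IntegrableOn (fun k : Fin N → ℝ => ∏ j, Real.sin (k j / 2) ^ (-(α / N)))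
      (torus N) := by
    rw [IntegrableOn, Measure.restrict_congr_set (torus_ae_eq_pi_Ioo N), volume_pi,
      Measure.restrict_pi_pi]
    exact Integrable.fintype_prod (f := fun _ (t : ℝ) => Real.sin (t / 2) ^ (-(α / N)))
      fun _ => integrableOn_sin_half_rpow_neg (by positivity) ((div_lt_one hN').2 hαN)
  refine Integrable.mono' hprod (continuous_symbol.measurable.pow_const _).aestronglyMeasurable ?_
  filter_upwards [ae_torus_mem_Ioo N] with k hk
  have hsin : ∀ j, 0 < Real.sin (k j / 2) := fun j => sin_half_pos (hk j)
  calc ‖symbol k ^ (-(α / 2))‖ = symbol k ^ (-(α / 2)) :=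
        Real.norm_of_nonneg (Real.rpow_nonneg (symbol_nonneg k) _)
    _ ≤ (∏ j, Real.sin (k j / 2) ^ (2 / N : ℝ)) ^ (-(α / 2)) :=
        Real.rpow_le_rpow_of_nonpos (Finset.prod_pos fun j _ => Real.rpow_pos_of_pos (hsin j) _)
          (prod_sin_le_symbol hN hk) (by linarith)
    _ = ∏ j, Real.sin (k j / 2) ^ (-(α / N)) := by
        rw [← Real.finsetProd_rpow _ _ fun j _ => Real.rpow_nonneg (hsin j).le _]
        refine Finset.prod_congr rfl fun j _ => ?_
        rw [← Real.rpow_mul (hsin j).le]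
        congr 1
        field_simp

/-- The pairing `x · k` of a lattice point with a frequency. -/
def pairing (x : Fin N → ℤ) (k : Fin N → ℝ) : ℝ := ∑ j, (x j : ℝ) * k j

@[fun_prop]
theorem continuous_pairing (x : Fin N → ℤ) : Continuous (pairing x) := by
  unfold pairing
  fun_prop

theorem pairing_single (j : Fin N) (k : Fin N → ℝ) : pairing (Pi.single j 1) k = k j := by
  simp [pairing, Pi.single_apply]

theorem pairing_add (x y : Fin N → ℤ) (k : Fin N → ℝ) :
    pairing (x + y) k = pairing x k + pairing y k := by
  simp [pairing, add_mul, Finset.sum_add_distrib]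

theorem pairing_neg (x : Fin N → ℤ) (k : Fin N → ℝ) : pairing (-x) k = -pairing x k := by
  simp [pairing]

/-- The (unnormalized) Fourier cosine coefficient `∫ cos (x · k) g(k) dk` over the torus. -/
def cosCoeff (g : (Fin N → ℝ) → ℝ) (x : Fin N → ℤ) : ℝ :=
  ∫ k in torus N, Real.cos (pairing x k) * g k

theorem integrableOn_cos_pairing_mul {g : (Fin N → ℝ) → ℝ} (hg : IntegrableOn g (torus N))
    (x : Fin N → ℤ) : IntegrableOn (fun k => Real.cos (pairing x k) * g k) (torus N) :=
  hg.bdd_mul (c := 1) (Continuous.aestronglyMeasurable (by fun_prop))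
    (ae_of_all _ fun _ => Real.abs_cos_le_one _)

theorem cosCoeff_const_mul (c : ℝ) (g : (Fin N → ℝ) → ℝ) (x : Fin N → ℤ) :
    cosCoeff (fun k => c * g k) x = c * cosCoeff g x := by
  simp only [cosCoeff, ← integral_const_mul, mul_left_comm]

theorem cosCoeff_neg (g : (Fin N → ℝ) → ℝ) (x : Fin N → ℤ) : cosCoeff g (-x) = cosCoeff g x := by
  simp only [cosCoeff, pairing_neg, Real.cos_neg]

theorem cosCoeff_le_zero {g : (Fin N → ℝ) → ℝ} (hg : IntegrableOn g (torus N)) (hg0 : ∀ k, 0 ≤ g k)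
    (x : Fin N → ℤ) : cosCoeff g x ≤ cosCoeff g 0 := by
  refine integral_mono (integrableOn_cos_pairing_mul hg x) (integrableOn_cos_pairing_mul hg 0)
    fun k => mul_le_mul_of_nonneg_right ?_ (hg0 k)
  simpa [pairing] using Real.cos_le_one _

theorem integral_exp_int_mul_I (n : ℤ) :
    ∫ t in Icc 0 (2 * Real.pi), Complex.exp ((n * t : ℝ) * Complex.I) =
      if n = 0 then 2 * Real.pi else 0 := by
  rw [integral_Icc_eq_integral_Ioc, ← intervalIntegral.integral_of_le (by positivity)]
  split_ifs with hn
  · simp [hn]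
  · have hc : Complex.I * n ≠ 0 := mul_ne_zero Complex.I_ne_zero (by exact_mod_cast hn)
    have hperiod : Complex.exp (Complex.I * n * (2 * Real.pi : ℝ)) = 1 := by
      rw [← Complex.exp_int_mul_two_pi_mul_I n]
      congr 1
      push_cast
      ring
    have h := integral_exp_mul_complex (a := 0) (b := 2 * Real.pi) hc
    rw [hperiod] at h
    simpa [mul_comm, mul_assoc, mul_left_comm] using h

theorem cosCoeff_one_nonneg (x : Fin N → ℤ) : 0 ≤ cosCoeff (fun _ => 1) x := by
  have hcos : ∀ k, Real.cos (pairing x k) =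
      (∏ j, Complex.exp ((x j * k j : ℝ) * Complex.I)).re := fun k => by
    rw [← Complex.exp_sum, ← Finset.sum_mul, ← Complex.ofReal_sum, Complex.exp_ofReal_mul_I_re,
      pairing]
  have hint : IntegrableOn
      (fun k : Fin N → ℝ => ∏ j, Complex.exp ((x j * k j : ℝ) * Complex.I)) (torus N) :=
    ContinuousOn.integrableOn_compact (isCompact_torus N) (by fun_prop)
  have hval : cosCoeff (fun _ => 1) x = ∏ j, if x j = 0 then 2 * Real.pi else 0 := by
    have hre := integral_re (𝕜 := ℂ) hint
    simp only [RCLike.re_to_complex] at hre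
    simp only [cosCoeff, mul_one, hcos]
    rw [hre, torus, ← pi_univ_Icc, volume_pi, Measure.restrict_pi_pi,
      integral_fintype_prod_eq_prod
        (f := fun j (t : ℝ) => Complex.exp ((x j * t : ℝ) * Complex.I))]
    simp only [integral_exp_int_mul_I]
    exact_mod_cast Complex.ofReal_re _
  rw [hval]
  exact Finset.prod_nonneg fun j _ => by positivity

/-- The mean of the cosines of the frequencies, so that `μ = 2N (1 - cosMean)`. -/
def cosMean (k : Fin N → ℝ) : ℝ := (∑ j, Real.cos (k j)) / N

@[fun_prop]
theorem continuous_cosMean : Continuous (cosMean : (Fin N → ℝ) → ℝ) := by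
  unfold cosMean
  fun_prop

theorem abs_cosMean_le_one (k : Fin N → ℝ) : |cosMean k| ≤ 1 := by
  rw [cosMean, abs_div, Nat.abs_cast]
  refine div_le_one_of_le₀ ((Finset.abs_sum_le_sum_abs _ _).trans ?_) N.cast_nonneg
  exact (Finset.sum_le_sum fun j _ => Real.abs_cos_le_one (k j)).trans (by simp)

theorem symbol_eq_mul_one_sub_cosMean (hN : N ≠ 0) (k : Fin N → ℝ) :
    symbol k = 2 * N * (1 - cosMean k) := by
  have : (N : ℝ) ≠ 0 := by exact_mod_cast hN
  rw [symbol, cosMean]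
  field_simp

theorem cosCoeff_cosMean_mul {g : (Fin N → ℝ) → ℝ} (hg : IntegrableOn g (torus N))
    (x : Fin N → ℤ) :
    cosCoeff (fun k => cosMean k * g k) x =
      1 / (2 * N) * ∑ j, (cosCoeff g (x + Pi.single j 1) + cosCoeff g (x + -Pi.single j 1)) := by
  have hint := integrableOn_cos_pairing_mul hg
  have hexp : ∀ k, Real.cos (pairing x k) * (cosMean k * g k) =
      1 / (2 * N) * ∑ j, (Real.cos (pairing (x + Pi.single j 1) k) * g k +
        Real.cos (pairing (x + -Pi.single j 1) k) * g k) := fun k => by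
    simp only [pairing_add, pairing_neg, pairing_single, Real.cos_add, Real.cos_neg, Real.sin_neg,
      cosMean, Finset.sum_div, Finset.sum_mul, Finset.mul_sum]
    exact Finset.sum_congr rfl fun j _ => by ring
  simp only [cosCoeff, hexp]
  rw [integral_const_mul, integral_finsetSum]
  · simp only [integral_add (hint _) (hint _)]
  · exact fun j _ => (hint _).add (hint _)

theorem cosCoeff_cosMean_pow_nonneg (n : ℕ) (x : Fin N → ℤ) :
    0 ≤ cosCoeff (fun k => cosMean k ^ n) x := by
  induction n generalizing x with
  | zero => simpa only [pow_zero] using cosCoeff_one_nonneg x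
  | succ n ih =>
    have hint : IntegrableOn (fun k : Fin N → ℝ => cosMean k ^ n) (torus N) :=
      ContinuousOn.integrableOn_compact (isCompact_torus N) (by fun_prop)
    simp only [pow_succ', cosCoeff_cosMean_mul hint]
    exact mul_nonneg (by positivity) (Finset.sum_nonneg fun j _ => add_nonneg (ih _) (ih _))

theorem cosCoeff_nonneg_of_hasSum {a : ℕ → ℝ} (ha : ∀ n, 0 ≤ a n) (hsum : Summable a)
    {g : (Fin N → ℝ) → ℝ} (hg : ∀ k, HasSum (fun n => a n * cosMean k ^ n) (g k))
    (x : Fin N → ℤ) : 0 ≤ cosCoeff g x := by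
  have hint : ∀ n, IntegrableOn (fun k => Real.cos (pairing x k) * (a n * cosMean k ^ n))
      (torus N) := fun n => ContinuousOn.integrableOn_compact (isCompact_torus N) (by fun_prop)
  have hbound : ∀ n, ∫ k in torus N, ‖Real.cos (pairing x k) * (a n * cosMean k ^ n)‖ ≤
      volume.real (torus N) * a n := fun n => by
    have hconst : IntegrableOn (fun _ : Fin N → ℝ => a n) (torus N) :=
      continuousOn_const.integrableOn_compact (isCompact_torus N)
    refine (integral_mono (hint n).norm hconst fun k => ?_).trans_eq (by simp)
    simp only [norm_mul, norm_pow, Real.norm_eq_abs, abs_of_nonneg (ha n)]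
    exact (mul_le_of_le_one_left (mul_nonneg (ha n) (by positivity)) (Real.abs_cos_le_one _)).trans
      (mul_le_of_le_one_right (ha n) (pow_le_one₀ (abs_nonneg _) (abs_cosMean_le_one k)))
  have h := hasSum_integral_of_summable_integral_norm hint
    (.of_nonneg_of_le (fun n => integral_nonneg fun _ => norm_nonneg _) hbound (hsum.mul_left _))
  have hg' : cosCoeff g x =
      ∫ k in torus N, ∑' n, Real.cos (pairing x k) * (a n * cosMean k ^ n) := by
    simp only [cosCoeff, ((hg _).mul_left _).tsum_eq]
  rw [hg', ← h.tsum_eq]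
  refine tsum_nonneg fun n => ?_
  have := mul_nonneg (ha n) (cosCoeff_cosMean_pow_nonneg n x)
  rwa [← cosCoeff_const_mul] at this

theorem choose_add_sub_one_nonneg {a : ℝ} (ha : 0 < a) (n : ℕ) : 0 ≤ Ring.choose (a + n - 1) n := by
  have h := Ring.factorial_nsmul_multichoose_eq_ascPochhammer a n
  rw [Polynomial.ascPochhammer_smeval_eq_eval, nsmul_eq_mul] at h
  rw [Ring.choose, show a + n - 1 - n + 1 = a by ring]
  exact (pos_of_mul_pos_right (h ▸ ascPochhammer_pos n a ha) n.factorial.cast_nonneg).le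

theorem hasSum_one_sub_rpow_neg (a : ℝ) {z : ℝ} (hz : |z| < 1) :
    HasSum (fun n : ℕ => Ring.choose (a + n - 1) n * z ^ n) ((1 - z) ^ (-a)) := by
  have h := (Real.one_div_one_sub_rpow_hasFPowerSeriesOnBall_zero a).hasSum (y := z)
    (by simpa [enorm_eq_nnnorm, ← NNReal.coe_lt_coe] using hz)
  rw [zero_add, one_div, ← Real.rpow_neg (by linarith [le_abs_self z])] at h
  simpa [FormalMultilinearSeries.ofScalars_apply_eq, mul_comm] using h

theorem cosCoeff_one_sub_mul_cosMean_rpow_neg_nonneg {a r : ℝ} (ha : 0 < a) (hr : 0 ≤ r)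
    (hr1 : r < 1) (x : Fin N → ℤ) : 0 ≤ cosCoeff (fun k => (1 - r * cosMean k) ^ (-a)) x := by
  have hz : ∀ k : Fin N → ℝ, |r * cosMean k| < 1 := fun k => by
    rw [abs_mul, abs_of_nonneg hr]
    exact (mul_le_of_le_one_right hr (abs_cosMean_le_one k)).trans_lt hr1
  refine cosCoeff_nonneg_of_hasSum (a := fun n => Ring.choose (a + n - 1) n * r ^ n)
    (fun n => mul_nonneg (choose_add_sub_one_nonneg ha n) (by positivity))
    (hasSum_one_sub_rpow_neg a (by rwa [abs_of_nonneg hr])).summable (fun k => ?_) x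
  simpa only [mul_pow, mul_assoc] using hasSum_one_sub_rpow_neg a (hz k)

theorem half_one_sub_le_one_sub_mul {c r : ℝ} (hc : |c| ≤ 1) (hr : 0 ≤ r) (hr1 : r ≤ 1) :
    (1 - c) / 2 ≤ 1 - r * c := by
  obtain ⟨h₁, h₂⟩ := abs_le.1 hc
  nlinarith

-- The power series of `(1 - r c)^{-a}` has nonnegative coefficients; then let `r → 1`.
theorem cosCoeff_one_sub_cosMean_rpow_neg_nonneg {a : ℝ} (ha : 0 < a)
    (hint : IntegrableOn (fun k : Fin N → ℝ => (1 - cosMean k) ^ (-a)) (torus N))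
    (hpos : ∀ᵐ k ∂volume.restrict (torus N), 0 < 1 - cosMean k) (x : Fin N → ℤ) :
    0 ≤ cosCoeff (fun k => (1 - cosMean k) ^ (-a)) x := by
  have hr : ∀ᶠ r : ℝ in 𝓝[<] 1, r ∈ Ioo 0 1 := Ioo_mem_nhdsLT one_pos
  have hlim : Tendsto (fun r : ℝ => cosCoeff (fun k => (1 - r * cosMean k) ^ (-a)) x) (𝓝[<] 1)
      (𝓝 (cosCoeff (fun k => (1 - cosMean k) ^ (-a)) x)) := by
    refine tendsto_integral_filter_of_dominated_convergence
      (fun k => 2⁻¹ ^ (-a) * (1 - cosMean k) ^ (-a)) ?_ ?_ (hint.const_mul _) ?_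
    · refine .of_forall fun r => Measurable.aestronglyMeasurable ?_
      have h₁ := (continuous_pairing x).measurable
      have h₂ := (continuous_cosMean (N := N)).measurable
      fun_prop
    · filter_upwards [hr] with r hr
      filter_upwards [hpos] with k hk
      have hle := half_one_sub_le_one_sub_mul (abs_cosMean_le_one k) hr.1.le hr.2.le
      rw [norm_mul, Real.norm_of_nonneg (Real.rpow_nonneg (by linarith) _),
        ← Real.mul_rpow (by positivity) hk.le, inv_mul_eq_div]
      exact (mul_le_of_le_one_left (Real.rpow_nonneg (by linarith) _) (Real.abs_cos_le_one _)).trans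
        (Real.rpow_le_rpow_of_nonpos (by linarith) hle (by linarith))
    · filter_upwards [hpos] with k hk
      have : ContinuousAt (fun r : ℝ => Real.cos (pairing x k) * (1 - r * cosMean k) ^ (-a)) 1 :=
        continuousAt_const.mul (ContinuousAt.rpow_const (by fun_prop) (.inl (by linarith)))
      simpa using this.tendsto.mono_left nhdsWithin_le_nhds
  refine ge_of_tendsto hlim ?_
  filter_upwards [hr] with r hr
  exact cosCoeff_one_sub_mul_cosMean_rpow_neg_nonneg ha hr.1.le hr.2 x

theorem cosCoeff_symbol_rpow_neg_nonneg (hα : 0 < α) (hαN : α < N) (x : Fin N → ℤ) :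
    0 ≤ cosCoeff (fun k => symbol k ^ (-(α / 2))) x := by
  have hN : 0 < N := by exact_mod_cast hα.trans hαN
  have hsymb := symbol_eq_mul_one_sub_cosMean hN.ne'
  have hc : 0 ≤ (2 * N : ℝ) ^ (-(α / 2)) := by positivity
  have hnn : ∀ k : Fin N → ℝ, 0 ≤ 1 - cosMean k := fun k => by
    linarith [(abs_le.1 (abs_cosMean_le_one k)).2]
  have hpow : ∀ k : Fin N → ℝ, symbol k ^ (-(α / 2)) =
      (2 * N : ℝ) ^ (-(α / 2)) * (1 - cosMean k) ^ (-(α / 2)) := fun k => by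
    rw [hsymb, Real.mul_rpow (by positivity) (hnn k)]
  have hint := integrableOn_symbol_rpow_neg hα hαN
  simp only [hpow, cosCoeff_const_mul] at hint ⊢
  refine mul_nonneg hc (cosCoeff_one_sub_cosMean_rpow_neg_nonneg (by positivity) ?_ ?_ x)
  · exact (integrable_const_mul_iff (IsUnit.mk0 _ (by positivity)) _).1 hint
  · filter_upwards [ae_torus_mem_Ioo N] with k hk
    have : 0 < symbol k := (Finset.prod_pos fun j _ =>
      Real.rpow_pos_of_pos (sin_half_pos (hk j)) _).trans_le (prod_sin_le_symbol hN hk)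
    rw [hsymb] at this
    exact pos_of_mul_pos_right this (by positivity)

theorem fracDegree_nonneg (N : ℕ) (α : ℝ) : 0 ≤ fracDegree N α :=
  mul_nonneg (by positivity) (integral_nonneg fun k => Real.rpow_nonneg (symbol_nonneg k) _)

theorem green_eq_cosCoeff (hα : 0 < α) (hαN : α < N) (x y : Fin N → ℤ) :
    green α x y =
      fracDegree N α / (2 * Real.pi) ^ N * cosCoeff (fun k => symbol k ^ (-(α / 2))) (x - y) := by
  have hint : IntegrableOn (fun k : Fin N → ℝ =>
      Complex.exp (Complex.I * ((∑ j, ((x j - y j : ℤ) : ℝ) * k j : ℝ) : ℂ)) *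
        ((symbol k ^ (-(α / 2)) : ℝ) : ℂ)) (torus N) := by
    refine (integrableOn_symbol_rpow_neg hα hαN).ofReal.bdd_mul (c := 1)
      (Continuous.aestronglyMeasurable (by fun_prop)) (ae_of_all _ fun k => ?_)
    rw [mul_comm, Complex.norm_exp_ofReal_mul_I]
  have hre := integral_re (𝕜 := ℂ) hint
  simp only [RCLike.re_to_complex] at hre
  rw [green, Complex.re_ofReal_mul, ← hre]
  simp only [Complex.re_mul_ofReal, mul_comm Complex.I, Complex.exp_ofReal_mul_I_re]
  rfl

theorem green_nonneg (hα : 0 < α) (hαN : α < N) (x y : Fin N → ℤ) : 0 ≤ green α x y := by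
  rw [green_eq_cosCoeff hα hαN]
  exact mul_nonneg (div_nonneg (fracDegree_nonneg N α) (by positivity))
    (cosCoeff_symbol_rpow_neg_nonneg hα hαN _)

theorem green_comm (hα : 0 < α) (hαN : α < N) (x y : Fin N → ℤ) : green α x y = green α y x := by
  rw [green_eq_cosCoeff hα hαN, green_eq_cosCoeff hα hαN, ← neg_sub, cosCoeff_neg]

theorem green_le_green_zero (hα : 0 < α) (hαN : α < N) (x y : Fin N → ℤ) :
    green α x y ≤ green α (0 : Fin N → ℤ) 0 := by
  rw [green_eq_cosCoeff hα hαN, green_eq_cosCoeff hα hαN, sub_zero]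
  exact mul_le_mul_of_nonneg_left (cosCoeff_le_zero (integrableOn_symbol_rpow_neg hα hαN)
    (fun k => Real.rpow_nonneg (symbol_nonneg k) _) _)
    (div_nonneg (fracDegree_nonneg N α) (by positivity))

theorem abs_green_le (hα : 0 < α) (hαN : α < N) (x y : Fin N → ℤ) :
    |green α x y| ≤ green α (0 : Fin N → ℤ) 0 := by
  rw [abs_of_nonneg (green_nonneg hα hαN x y)]
  exact green_le_green_zero hα hαN x y

end Green

/-! ### Superposition operators between `ℓ^p` spaces -/

section Superposition

open scoped ENNReal

theorem toReal_one_pos : 0 < (1 : ℝ≥0∞).toReal := by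
  simp

theorem add_rpow_le_two_rpow_mul {a b s : ℝ} (ha : 0 ≤ a) (hb : 0 ≤ b) (hs : 0 ≤ s) :
    (a + b) ^ s ≤ 2 ^ s * (a ^ s + b ^ s) := by
  have hmax : 0 ≤ max a b := ha.trans (le_max_left a b)
  calc (a + b) ^ s ≤ (2 * max a b) ^ s :=
        Real.rpow_le_rpow (by positivity) (by linarith [le_max_left a b, le_max_right a b]) hs
    _ = 2 ^ s * max a b ^ s := Real.mul_rpow (by positivity) hmax
    _ ≤ 2 ^ s * (a ^ s + b ^ s) := by
        refine mul_le_mul_of_nonneg_left ?_ (by positivity)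
        have h₁ := Real.rpow_nonneg ha s
        have h₂ := Real.rpow_nonneg hb s
        rcases max_choice a b with h | h <;> rw [h] <;> linarith

variable {ι V W : Type*} [NormedAddCommGroup V] [NormedAddCommGroup W] {p q : ℝ≥0∞}

/-- On every bounded set `‖g a‖` is controlled by a multiple of `‖a‖ ^ s`. As the members of `ℓ^p`
are bounded, nothing is required of the growth of `g` at infinity. -/
def PowerGrowth (g : V → W) (s : ℝ) : Prop :=
  ∀ r, ∃ C, 0 ≤ C ∧ ∀ a, ‖a‖ ≤ r → ‖g a‖ ≤ C * ‖a‖ ^ s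

theorem PowerGrowth.memℓp {g : V → W} (hg : PowerGrowth g (p.toReal / q.toReal))
    (hp : 0 < p.toReal) (hq : 0 < q.toReal) (u : lp (fun _ : ι => V) p) :
    Memℓp (fun i => g (u i)) q := by
  obtain ⟨C, hC, hgC⟩ := hg ‖u‖
  refine memℓp_gen <| .of_nonneg_of_le (fun i => by positivity) (fun i => ?_)
    (((lp.memℓp u).summable hp).mul_left (C ^ q.toReal))
  have hp0 : p ≠ 0 := (ENNReal.toReal_pos_iff.1 hp).1.ne'
  calc ‖g (u i)‖ ^ q.toReal ≤ (C * ‖u i‖ ^ (p.toReal / q.toReal)) ^ q.toReal :=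
        Real.rpow_le_rpow (norm_nonneg _) (hgC _ (lp.norm_apply_le_norm hp0 u i)) hq.le
    _ = C ^ q.toReal * ‖u i‖ ^ p.toReal := by
        rw [Real.mul_rpow hC (by positivity), ← Real.rpow_mul (norm_nonneg _),
          div_mul_cancel₀ _ hq.ne']

theorem PowerGrowth.norm_sub_rpow_le {g : V → W} {s t : ℝ} (hg : PowerGrowth g (s / t))
    (hs : 0 < s) (ht : 0 < t) (r : ℝ) :
    ∃ K, 0 ≤ K ∧ ∀ a b, ‖a‖ ≤ r → ‖b‖ ≤ r →
      ‖g a - g b‖ ^ t ≤ K * ‖a - b‖ ^ s + K * ‖b‖ ^ s := by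
  obtain ⟨C, hC, hgC⟩ := hg r
  refine ⟨(2 * C) ^ t * 2 ^ s, by positivity, fun a b ha hb => ?_⟩
  have hle : ∀ c, ‖c‖ ≤ ‖a - b‖ + ‖b‖ → ‖c‖ ≤ r →
      ‖g c‖ ≤ C * (‖a - b‖ + ‖b‖) ^ (s / t) := fun c hc hcr =>
    (hgC c hcr).trans (mul_le_mul_of_nonneg_left
      (Real.rpow_le_rpow (norm_nonneg _) hc (by positivity)) hC)
  calc ‖g a - g b‖ ^ t ≤ (2 * C * (‖a - b‖ + ‖b‖) ^ (s / t)) ^ t := by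
        refine Real.rpow_le_rpow (norm_nonneg _) ((norm_sub_le _ _).trans ?_) ht.le
        linarith [hle a (norm_le_norm_sub_add a b) ha,
          hle b (le_add_of_nonneg_left (norm_nonneg _)) hb]
    _ = (2 * C) ^ t * (‖a - b‖ + ‖b‖) ^ s := by
        rw [Real.mul_rpow (by positivity) (by positivity), ← Real.rpow_mul (by positivity),
          div_mul_cancel₀ _ ht.ne']
    _ ≤ (2 * C) ^ t * (2 ^ s * (‖a - b‖ ^ s + ‖b‖ ^ s)) := by
        refine mul_le_mul_of_nonneg_left ?_ (by positivity)
        exact add_rpow_le_two_rpow_mul (norm_nonneg _) (norm_nonneg _) hs.le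
    _ = _ := by ring

theorem PowerGrowth.of_fderiv [NormedSpace ℝ V] {φ : V → ℝ} {φ' : V → V →L[ℝ] ℝ} {s : ℝ}
    (hs : 0 ≤ s) (hφ0 : φ 0 = 0) (hφ : ∀ a, HasFDerivAt φ (φ' a) a) (hφ' : PowerGrowth φ' s) :
    PowerGrowth φ (s + 1) := fun r => by
  obtain ⟨C, hC, hle⟩ := hφ' r
  refine ⟨C, hC, fun a ha => ?_⟩
  have hbound : ∀ z ∈ Metric.closedBall (0 : V) ‖a‖, ‖φ' z‖ ≤ C * ‖a‖ ^ s := fun z hz => by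
    rw [mem_closedBall_zero_iff] at hz
    exact (hle z (hz.trans ha)).trans
      (mul_le_mul_of_nonneg_left (Real.rpow_le_rpow (norm_nonneg _) hz hs) hC)
  have := (convex_closedBall (0 : V) ‖a‖).norm_image_sub_le_of_norm_hasFDerivWithin_le
    (fun z _ => (hφ z).hasFDerivWithinAt) hbound (Metric.mem_closedBall_self (norm_nonneg a))
    (mem_closedBall_zero_iff.2 le_rfl)
  rwa [hφ0, sub_zero, sub_zero, mul_assoc, ← Real.rpow_add_one' (norm_nonneg _) (by linarith)]
    at this

/-- The superposition (Nemytskii) operator `u ↦ g ∘ u` from `ℓ^p` to `ℓ^q`. -/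
def superposition {g : V → W} (hg : PowerGrowth g (p.toReal / q.toReal)) (hp : 0 < p.toReal)
    (hq : 0 < q.toReal) (u : lp (fun _ : ι => V) p) : lp (fun _ : ι => W) q :=
  ⟨fun i => g (u i), hg.memℓp hp hq u⟩

theorem tendsto_tsum_of_le_add {β : Type*} {l : Filter β} {a b : β → ι → ℝ} {c : ι → ℝ}
    (ha : ∀ z i, 0 ≤ a z i) (hb : ∀ z i, 0 ≤ b z i) (hc : ∀ i, 0 ≤ c i)
    (hle : ∀ᶠ z in l, ∀ i, a z i ≤ b z i + c i) (hbs : ∀ z, Summable (b z)) (hcs : Summable c)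
    (hai : ∀ i, Tendsto (a · i) l (𝓝 0)) (hbl : Tendsto (fun z => ∑' i, b z i) l (𝓝 0)) :
    Tendsto (fun z => ∑' i, a z i) l (𝓝 0) := by
  have hexcess : ∀ᶠ z in l, ∀ i, max 0 (a z i - b z i) ≤ c i := by
    filter_upwards [hle] with z hz i using max_le (hc i) (sub_le_iff_le_add'.2 (hz i))
  have hlim : Tendsto (fun z => ∑' i, max 0 (a z i - b z i)) l (𝓝 0) := by
    suffices Tendsto (fun z => ∑' i, max 0 (a z i - b z i)) l (𝓝 (∑' _ : ι, 0)) by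
      rwa [tsum_zero] at this
    refine tendsto_tsum_of_dominated_convergence hcs (fun i => ?_) ?_
    · exact squeeze_zero (fun z => le_max_left _ _)
        (fun z => max_le (ha z i) (sub_le_self _ (hb z i))) (hai i)
    · filter_upwards [hexcess] with z hz i
      rw [Real.norm_of_nonneg (le_max_left _ _)]
      exact hz i
  refine squeeze_zero' (.of_forall fun z => tsum_nonneg (ha z)) ?_
    (by simpa only [add_zero] using hbl.add hlim)
  filter_upwards [hexcess] with z hz
  have hs : Summable fun i => max 0 (a z i - b z i) :=
    hcs.of_nonneg_of_le (fun i => le_max_left _ _) hz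
  have hab : ∀ i, a z i ≤ b z i + max 0 (a z i - b z i) := fun i => by
    linarith [le_max_right 0 (a z i - b z i)]
  rw [← (hbs z).tsum_add hs]
  exact ((hbs z).add hs |>.of_nonneg_of_le (ha z) hab).tsum_le_tsum hab ((hbs z).add hs)

variable [Fact (1 ≤ p)] [Fact (1 ≤ q)]

theorem continuous_superposition {g : V → W} (hg : PowerGrowth g (p.toReal / q.toReal))
    (hgc : Continuous g) (hp : 0 < p.toReal) (hq : 0 < q.toReal) :
    Continuous (superposition hg hp hq : lp (fun _ : ι => V) p → lp (fun _ : ι => W) q) := by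
  refine continuous_iff_continuousAt.2 fun u => tendsto_iff_norm_sub_tendsto_zero.2 ?_
  have hp0 : p ≠ 0 := (ENNReal.toReal_pos_iff.1 hp).1.ne'
  obtain ⟨K, hK, hle⟩ := hg.norm_sub_rpow_le hp hq (‖u‖ + 1)
  have hcoord : ∀ i, Continuous fun z : lp (fun _ : ι => V) p => z i := fun i =>
    (continuous_apply i).comp lp.uniformContinuous_coe.continuous
  have hnorm : Tendsto (fun z => ∑' i, K * ‖(z - u) i‖ ^ p.toReal) (𝓝 u) (𝓝 0) := by
    simp only [tsum_mul_left, ← lp.norm_rpow_eq_tsum hp]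
    have : Continuous fun z : lp (fun _ : ι => V) p => K * ‖z - u‖ ^ p.toReal := by
      fun_prop (disch := exact hp.le)
    simpa [Real.zero_rpow hp.ne'] using this.tendsto u
  have hsum : Tendsto (fun z : lp (fun _ : ι => V) p => ∑' i, ‖g (z i) - g (u i)‖ ^ q.toReal)
      (𝓝 u) (𝓝 0) := by
    refine tendsto_tsum_of_le_add (b := fun z i => K * ‖(z - u) i‖ ^ p.toReal)
      (c := fun i => K * ‖u i‖ ^ p.toReal) (fun _ _ => by positivity) (fun _ _ => by positivity)
      (fun _ => by positivity) ?_ (fun z => ((lp.memℓp (z - u)).summable hp).mul_left K)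
      (((lp.memℓp u).summable hp).mul_left K) (fun i => ?_) hnorm
    · filter_upwards [Metric.closedBall_mem_nhds u one_pos] with z hz i
      refine hle _ _ ((lp.norm_apply_le_norm hp0 z i).trans ?_)
        ((lp.norm_apply_le_norm hp0 u i).trans (by linarith))
      linarith [norm_le_norm_add_norm_sub' z u, mem_closedBall_iff_norm.1 hz]
    · have : Continuous fun z : lp (fun _ : ι => V) p => ‖g (z i) - g (u i)‖ ^ q.toReal :=
        (((hgc.comp (hcoord i)).sub continuous_const).norm).rpow_const fun _ => .inr hq.le
      simpa [Real.zero_rpow hq.ne'] using this.tendsto u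
  have hroot := hsum.rpow_const (p := 1 / q.toReal) (.inr (by positivity))
  rw [Real.zero_rpow (by positivity)] at hroot
  exact hroot.congr fun z => (lp.norm_eq_tsum_rpow hq _).symm

variable [NormedSpace ℝ V] {φ : V → ℝ} {φ' : V → V →L[ℝ] ℝ}

theorem exists_lp_mvt (hφ : ∀ a, HasFDerivAt φ (φ' a) a) (x y : lp (fun _ : ι => V) p) :
    ∃ z : lp (fun _ : ι => V) p, (∀ i, φ (x i) - φ (y i) = φ' (z i) (x i - y i)) ∧
      ‖z - y‖ ≤ ‖x - y‖ := by
  choose z hz hzφ using fun i => domain_mvt (s := univ)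
    (fun a _ => (hφ a).hasFDerivWithinAt) convex_univ (mem_univ (y i)) (mem_univ (x i))
  have hp0 : p ≠ 0 := (zero_lt_one.trans_le (Fact.out : 1 ≤ p)).ne'
  have hdist : ∀ i, ‖z i - y i‖ ≤ ‖(x - y) i‖ := fun i => by
    rw [← dist_eq_norm, lp.coeFn_sub, Pi.sub_apply, ← dist_eq_norm, dist_comm (x i)]
    linarith [dist_add_dist_of_mem_segment (hz i), dist_nonneg (x := z i) (y := x i),
      dist_comm (z i) (y i)]
  have hmem : Memℓp z p := by
    have : Memℓp (fun i => z i - y i) p := (lp.memℓp (x - y)).mono' hdist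
    simpa only [Pi.add_def, add_sub_cancel] using (lp.memℓp y).add this
  exact ⟨⟨z, hmem⟩, hzφ, lp.norm_mono hp0 hdist⟩

theorem hasStrictFDerivAt_superposition [p.HolderConjugate q] (hφ : ∀ a, HasFDerivAt φ (φ' a) a)
    (hφ'c : Continuous φ') (hp : 0 < p.toReal) (hq : 0 < q.toReal)
    (hg : PowerGrowth φ (p.toReal / (1 : ℝ≥0∞).toReal))
    (hg' : PowerGrowth φ' (p.toReal / q.toReal)) (u : lp (fun _ : ι => V) p) :
    HasStrictFDerivAt (superposition hg hp toReal_one_pos : _ → lp (fun _ : ι => ℝ) 1)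
      (lp.holderL (K := 1) 1 (fun _ => ContinuousLinearMap.id ℝ (V →L[ℝ] ℝ))
        (fun _ => ContinuousLinearMap.norm_id_le) (superposition hg' hp hq u)) u := by
  set B : lp (fun _ : ι => V →L[ℝ] ℝ) q →L[ℝ] lp (fun _ : ι => V) p →L[ℝ] lp (fun _ : ι => ℝ) 1 :=
    lp.holderL (K := 1) 1 (fun _ => ContinuousLinearMap.id ℝ (V →L[ℝ] ℝ))
      fun _ => ContinuousLinearMap.norm_id_le
  have hB : ∀ e w, ‖B e w‖ ≤ ‖e‖ * ‖w‖ := fun e w => by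
    simpa using B.le_of_opNorm₂_le_of_le (lp.norm_holderL_le _ _ _) le_rfl le_rfl
  refine .of_isLittleO (Asymptotics.isLittleO_iff.2 fun c hc => ?_)
  obtain ⟨δ, hδ, hcont⟩ := Metric.continuous_iff.1
    (continuous_superposition (ι := ι) hg' hφ'c hp hq) u c hc
  have hnear : ∀ᶠ xy : lp (fun _ : ι => V) p × lp (fun _ : ι => V) p in 𝓝 (u, u),
      ‖xy.1 - xy.2‖ + ‖xy.2 - u‖ < δ :=
    ContinuousAt.eventually_lt (by fun_prop) continuousAt_const (by simpa using hδ)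
  filter_upwards [hnear] with ⟨x, y⟩ hxy
  obtain ⟨z, hz, hzy⟩ := exists_lp_mvt hφ x y
  have hzu : dist z u < δ := by
    rw [dist_eq_norm]
    linarith [norm_sub_le_norm_sub_add_norm_sub z y u]
  have hrem : superposition hg hp toReal_one_pos x - superposition hg hp toReal_one_pos y -
      B (superposition hg' hp hq u) (x - y) =
      B (superposition hg' hp hq z - superposition hg' hp hq u) (x - y) := by
    rw [map_sub B, sub_apply, sub_left_inj]
    exact lp.ext (funext fun i => hz i)
  rw [hrem]
  refine (hB _ _).trans (mul_le_mul_of_nonneg_right ?_ (norm_nonneg _))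
  rw [← dist_eq_norm]
  exact (hcont z hzu).le

theorem exists_hasStrictFDerivAt_superposition (hφ : ∀ a, HasFDerivAt φ (φ' a) a)
    (hφ'c : Continuous φ') (hp : 1 < p.toReal)
    (hg : PowerGrowth φ (p.toReal / (1 : ℝ≥0∞).toReal))
    (hg' : PowerGrowth φ' (p.toReal - 1)) (u : lp (fun _ : ι => V) p) :
    ∃ D : lp (fun _ : ι => V) p →L[ℝ] lp (fun _ : ι => ℝ) 1,
      HasStrictFDerivAt (superposition hg (zero_lt_one.trans hp) toReal_one_pos) D u ∧
        ∀ w i, D w i = φ' (u i) (w i) := by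
  have hpq : p.toReal.HolderConjugate (ENNReal.conjExponent p).toReal :=
    ENNReal.HolderConjugate.toReal hp
  have : Fact (1 ≤ ENNReal.conjExponent p) := ⟨ENNReal.HolderConjugate.one_le _ p⟩
  rw [← hpq.div_conj_eq_sub_one] at hg'
  exact ⟨_, hasStrictFDerivAt_superposition hφ hφ'c hpq.pos hpq.symm.pos hg hg' u, fun _ _ => rfl⟩

end Superposition

section KernelForm

open scoped ENNReal NNReal

variable {ι : Type*} {K : ι → ι → ℝ} {R : ℝ≥0}

theorem summable_norm_coe (a : lp (fun _ : ι => ℝ) 1) : Summable fun i => ‖a i‖ := by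
  simpa using (lp.memℓp a).summable toReal_one_pos

theorem norm_eq_tsum_norm (a : lp (fun _ : ι => ℝ) 1) : ‖a‖ = ∑' i, ‖a i‖ := by
  simp [lp.norm_eq_tsum_rpow toReal_one_pos]

theorem summable_kernel_mul (hK : ∀ x y, |K x y| ≤ R) (a : lp (fun _ : ι => ℝ) 1) (x : ι) :
    Summable fun y => K x y * a y :=
  .of_norm_bounded ((summable_norm_coe a).mul_left (R : ℝ)) fun y => by
    rw [norm_mul]
    exact mul_le_mul_of_nonneg_right (hK x y) (norm_nonneg _)

theorem abs_tsum_kernel_mul_le (hK : ∀ x y, |K x y| ≤ R) (a : lp (fun _ : ι => ℝ) 1) (x : ι) :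
    |∑' y, K x y * a y| ≤ R * ‖a‖ := by
  rw [norm_eq_tsum_norm, ← tsum_mul_left]
  refine tsum_of_norm_bounded (E := ℝ) ((summable_norm_coe a).mul_left (R : ℝ)).hasSum fun y => ?_
  rw [norm_mul]
  exact mul_le_mul_of_nonneg_right (hK x y) (norm_nonneg _)

/-- The operator `a ↦ (∑ y, K x y * a y)` from `ℓ^1` to `ℓ^∞` with a bounded kernel `K`. -/
def kernelOp (hK : ∀ x y, |K x y| ≤ R) :
    lp (fun _ : ι => ℝ) 1 →L[ℝ] lp (fun _ : ι => ℝ) ∞ :=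
  LinearMap.mkContinuous
    { toFun a := ⟨fun x => ∑' y, K x y * a y, memℓp_infty
        ⟨R * ‖a‖, forall_mem_range.2 (abs_tsum_kernel_mul_le hK a)⟩⟩
      map_add' a b := by
        ext x
        simp only [lp.coeFn_add, Pi.add_apply, mul_add]
        exact (summable_kernel_mul hK a x).tsum_add (summable_kernel_mul hK b x)
      map_smul' c a := by
        ext x
        simp only [lp.coeFn_smul, Pi.smul_apply, smul_eq_mul, RingHom.id_apply,
          mul_left_comm _ c, tsum_mul_left] }
    R fun a => lp.norm_le_of_forall_le (by positivity) (abs_tsum_kernel_mul_le hK a)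

/-- The bilinear form `∑ x, (∑ y, K x y * a y) * b x` on `ℓ^1` of a bounded kernel `K`. -/
def kernelForm (hK : ∀ x y, |K x y| ≤ R) :
    lp (fun _ : ι => ℝ) 1 →L[ℝ] lp (fun _ : ι => ℝ) 1 →L[ℝ] ℝ :=
  lp.dualPairing (K := 1) ∞ 1 (fun _ => ContinuousLinearMap.mul ℝ ℝ)
    (fun _ => ContinuousLinearMap.opNorm_mul_le ℝ ℝ) ∘L kernelOp hK

theorem kernelForm_apply (hK : ∀ x y, |K x y| ≤ R) (a b : lp (fun _ : ι => ℝ) 1) :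
    kernelForm hK a b = ∑' x, (∑' y, K x y * a y) * b x :=
  rfl

theorem summable_kernelForm (hK : ∀ x y, |K x y| ≤ R) (a b : lp (fun _ : ι => ℝ) 1) :
    Summable fun x => (∑' y, K x y * a y) * b x :=
  .of_norm_bounded ((summable_norm_coe b).mul_left (R * ‖a‖)) fun x => by
    rw [norm_mul]
    exact mul_le_mul_of_nonneg_right (abs_tsum_kernel_mul_le hK a x) (norm_nonneg _)

theorem kernelForm_comm (hK : ∀ x y, |K x y| ≤ R) (hsymm : ∀ x y, K x y = K y x)
    (a b : lp (fun _ : ι => ℝ) 1) : kernelForm hK a b = kernelForm hK b a := by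
  have hs : Summable (Function.uncurry fun x y => K x y * a y * b x) := by
    refine .of_norm_bounded
      (((summable_norm_coe b).mul_of_nonneg (summable_norm_coe a) (fun _ => norm_nonneg _)
        fun _ => norm_nonneg _).mul_left (R : ℝ)) fun ⟨x, y⟩ => ?_
    rw [Function.uncurry_apply_pair, norm_mul, norm_mul, mul_assoc, mul_comm ‖a y‖]
    exact mul_le_mul_of_nonneg_right (hK x y) (by positivity)
  simp only [kernelForm_apply, ← tsum_mul_right]
  refine hs.tsum_comm.symm.trans ?_
  exact tsum_congr fun x => tsum_congr fun y => by rw [hsymm y x]; ring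

theorem kernelForm_mono_right (hK : ∀ x y, |K x y| ≤ R) (hK0 : ∀ x y, 0 ≤ K x y)
    {a b c : lp (fun _ : ι => ℝ) 1} (ha : ∀ i, 0 ≤ a i) (hbc : ∀ i, b i ≤ c i) :
    kernelForm hK a b ≤ kernelForm hK a c :=
  (summable_kernelForm hK a b).tsum_le_tsum
    (fun x => mul_le_mul_of_nonneg_left (hbc x) (tsum_nonneg fun y => mul_nonneg (hK0 x y) (ha y)))
    (summable_kernelForm hK a c)

theorem diag_le_kernelForm (hK : ∀ x y, |K x y| ≤ R) (hK0 : ∀ x y, 0 ≤ K x y)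
    {a b : lp (fun _ : ι => ℝ) 1} (ha : ∀ i, 0 ≤ a i) (hb : ∀ i, 0 ≤ b i) (x : ι) :
    K x x * a x * b x ≤ kernelForm hK a b := by
  have ha' : ∀ x, K x x * a x ≤ ∑' y, K x y * a y := fun x =>
    (summable_kernel_mul hK a x).le_tsum x fun y _ => mul_nonneg (hK0 x y) (ha y)
  have hnn : ∀ x, 0 ≤ ∑' y, K x y * a y := fun x => tsum_nonneg fun y => mul_nonneg (hK0 x y) (ha y)
  calc K x x * a x * b x ≤ (∑' y, K x y * a y) * b x := mul_le_mul_of_nonneg_right (ha' x) (hb x)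
    _ ≤ _ := (summable_kernelForm hK a b).le_tsum x fun y _ => mul_nonneg (hnn y) (hb y)

end KernelForm

/-! ### Minimization over Nehari sets -/

section Nehari

variable {E : Type*} [NormedAddCommGroup E] [NormedSpace ℝ E] {J : E → ℝ}

/-- The Nehari set of a functional `J` on a normed space. -/
def nehariSet (J : E → ℝ) : Set E := {u | u ≠ 0 ∧ fderiv ℝ J u u = 0}

/-- The Nehari set of `J` is crossed downward by the rays from the origin: along the ray through a
point `u` of the Nehari set, `J` increases before `u` and decreases after `u`. -/
def RaysCrossDownward (J : E → ℝ) : Prop :=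
  ∀ u ∈ nehariSet J, ∀ t : ℝ, 0 < t → t ≠ 1 → (t - 1) * fderiv ℝ J (t • u) u < 0

theorem hasDerivAt_ray (hJ : Differentiable ℝ J) (u : E) (t : ℝ) :
    HasDerivAt (fun s : ℝ => J (s • u)) (fderiv ℝ J (t • u) u) t := by
  have h := (hJ (t • u)).hasFDerivAt.comp_hasDerivAt t ((hasDerivAt_id' t).smul_const u)
  rw [one_smul] at h
  exact h

theorem RaysCrossDownward.of_strictAntiOn {s : ℝ}
    (hray : ∀ u ≠ 0, StrictAntiOn (fun t : ℝ => fderiv ℝ J (t • u) u / t ^ s) (Ioi 0)) :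
    RaysCrossDownward J := by
  rintro u ⟨hu0, hu⟩ t ht ht1
  have hanti := hray u hu0
  have hpos := Real.rpow_pos_of_pos ht s
  rcases ht1.lt_or_gt with hlt | hgt
  · have := hanti ht (mem_Ioi.2 one_pos) hlt
    simp only [one_smul, hu, zero_div, div_pos_iff_of_pos_right hpos] at this
    exact mul_neg_of_neg_of_pos (sub_neg.2 hlt) this
  · have := hanti (mem_Ioi.2 one_pos) ht hgt
    simp only [one_smul, hu, zero_div, div_lt_iff₀ hpos, zero_mul] at this
    exact mul_neg_of_pos_of_neg (sub_pos.2 hgt) this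

theorem RaysCrossDownward.apply_smul_lt (hcross : RaysCrossDownward J) (hJ : Differentiable ℝ J)
    {u : E} (hu : u ∈ nehariSet J) {t : ℝ} (ht : 0 ≤ t) (ht1 : t ≠ 1) : J (t • u) < J u := by
  have hcont : Continuous fun s : ℝ => J (s • u) := hJ.continuous.comp (by fun_prop)
  have hderiv := fun s => (hasDerivAt_ray hJ u s).deriv
  suffices J (t • u) < J ((1 : ℝ) • u) by rwa [one_smul] at this
  rcases ht1.lt_or_gt with hlt | hgt
  · refine strictMonoOn_of_deriv_pos (convex_Icc 0 1) hcont.continuousOn (fun s hs => ?_)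
      ⟨ht, hlt.le⟩ (right_mem_Icc.2 zero_le_one) hlt
    rw [interior_Icc] at hs
    rw [hderiv]
    nlinarith [hcross u hu s hs.1 hs.2.ne, hs.2]
  · refine strictAntiOn_of_deriv_neg (convex_Ici 1) hcont.continuousOn (fun s hs => ?_)
      self_mem_Ici hgt.le hgt
    rw [interior_Ici] at hs
    rw [hderiv]
    nlinarith [hcross u hu s (one_pos.trans hs) (ne_of_gt hs), mem_Ioi.1 hs]

theorem exists_smul_mem_nehariSet (hJ : Differentiable ℝ J) {u : E} (hu : u ≠ 0) {a b c : ℝ}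
    (ha : 0 ≤ a) (hc : c ∈ Icc a b) (hac : J (a • u) < J (c • u)) (hbc : J (b • u) < J (c • u)) :
    ∃ t ∈ Ioo a b, t • u ∈ nehariSet J := by
  have hcont : Continuous fun s : ℝ => J (s • u) := hJ.continuous.comp (by fun_prop)
  have hends : ∀ s ∈ Icc a b \ Ioo a b, J (s • u) < J (c • u) := by
    rw [Icc_sdiff_Ioo_same (hc.1.trans hc.2)]
    rintro s (rfl | rfl)
    exacts [hac, hbc]
  obtain ⟨t, ht, hmax⟩ := isCompact_Icc.exists_isLocalMax_mem_open Ioo_subset_Icc_self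
    hcont.continuousOn hc hends isOpen_Ioo
  refine ⟨t, ht, smul_ne_zero (ha.trans_lt ht.1).ne' hu, ?_⟩
  rw [map_smul, hmax.hasDerivAt_eq_zero (hasDerivAt_ray hJ u t), smul_zero]

theorem exists_forall_apply_smul_lt {u v : E} (hJ : HasStrictFDerivAt J (fderiv ℝ J u) u)
    (hv : fderiv ℝ J u v < 0) :
    ∃ δ ∈ Ioo (0 : ℝ) 1, ∀ t ∈ Icc (1 - δ) (1 + δ), ∀ s ∈ Ioo 0 δ,
      J (t • (u + s • v)) < J (t • u) := by
  have hv0 : 0 < ‖v‖ := norm_pos_iff.2 fun h => by simp [h] at hv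
  have hε : 0 < -fderiv ℝ J u v / (2 * ‖v‖) := div_pos (neg_pos.2 hv) (by positivity)
  have hlim : Tendsto (fun ts : ℝ × ℝ => (ts.1 • (u + ts.2 • v), ts.1 • u)) (𝓝 (1, 0))
      (𝓝 (u, u)) := Continuous.tendsto' (by fun_prop) _ _ (by simp)
  obtain ⟨δ, hδ, hball⟩ := Metric.eventually_nhds_iff_ball.1
    (hlim.eventually (Asymptotics.isLittleO_iff.1 hJ.isLittleO hε))
  refine ⟨min δ 1 / 2, ⟨by positivity, by linarith [min_le_right δ 1]⟩, fun t ht s hs => ?_⟩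
  have hδ' : min δ 1 / 2 < δ := by linarith [min_le_left δ 1, lt_min hδ one_pos]
  have ht0 : 0 < t := by linarith [ht.1, min_le_right δ 1]
  have hmem : (t, s) ∈ Metric.ball ((1 : ℝ), (0 : ℝ)) δ := by
    rw [← ball_prod_same, mem_prod, Real.ball_eq_Ioo, Real.ball_eq_Ioo]
    constructor <;> constructor <;> grind
  have hle := (le_abs_self _).trans (hball (t, s) hmem)
  have hsub : t • (u + s • v) - t • u = (t * s) • v := by module
  have hts : 0 < t * s := mul_pos ht0 hs.1
  rw [hsub, norm_smul, Real.norm_of_nonneg hts.le, map_smul, smul_eq_mul] at hle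
  have hhalf : -fderiv ℝ J u v / (2 * ‖v‖) * (t * s * ‖v‖) = -(t * s * fderiv ℝ J u v) / 2 := by
    field_simp
  rw [hhalf] at hle
  nlinarith [mul_neg_of_pos_of_neg hts hv]

/-- The Nehari set is a natural constraint. If `J'(u) v < 0`, the rays through `u + s v` still have
an interior maximum near `u`, hence meet the Nehari set, at a level below `J u`. -/
theorem RaysCrossDownward.fderiv_eq_zero (hcross : RaysCrossDownward J) (hJ : Differentiable ℝ J)
    {u : E} (hJu : HasStrictFDerivAt J (fderiv ℝ J u) u) (hu : u ∈ nehariSet J)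
    (hmin : ∀ v ∈ nehariSet J, J u ≤ J v) : fderiv ℝ J u = 0 := by
  by_contra hne
  obtain ⟨v, hv⟩ : ∃ v, fderiv ℝ J u v < 0 := by
    obtain ⟨v, hv⟩ := DFunLike.exists_ne hne
    rcases lt_or_gt_of_ne hv with h | h
    exacts [⟨v, h⟩, ⟨-v, by rw [map_neg]; exact neg_neg_of_pos h⟩]
  obtain ⟨δ, ⟨hδ0, hδ1⟩, hlt⟩ := exists_forall_apply_smul_lt hJu hv
  have hends : ∀ t : ℝ, 0 ≤ t → t ≠ 1 →
      ∀ᶠ s : ℝ in 𝓝 0, J (t • (u + s • v)) < J ((1 : ℝ) • (u + s • v)) := fun t ht ht1 => by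
    have hc : ∀ t : ℝ, Continuous fun s : ℝ => J (t • (u + s • v)) := fun t =>
      hJ.continuous.comp (by fun_prop)
    refine (hc t).continuousAt.eventually_lt (hc 1).continuousAt ?_
    simpa using hcross.apply_smul_lt hJ hu ht ht1
  have hne0 : ∀ᶠ s : ℝ in 𝓝 0, u + s • v ≠ 0 :=
    ContinuousAt.eventually_ne (by fun_prop) (by simpa using hu.1)
  have hsmall : ∀ᶠ s : ℝ in 𝓝[>] 0, s ∈ Ioo 0 δ := Ioo_mem_nhdsGT hδ0
  have hall := (hends (1 - δ) (by linarith) (by linarith)).and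
    ((hends (1 + δ) (by linarith) (by linarith)).and hne0)
  obtain ⟨s, ⟨hleft, hright, hs0⟩, hs⟩ :=
    ((hall.filter_mono nhdsWithin_le_nhds).and hsmall).exists
  obtain ⟨t, ht, htN⟩ := exists_smul_mem_nehariSet hJ hs0 (by linarith)
    ⟨by linarith, by linarith⟩ hleft hright
  have hle : J (t • u) ≤ J u := by
    rcases eq_or_ne t 1 with rfl | ht1
    · rw [one_smul]
    · exact (hcross.apply_smul_lt hJ hu (by linarith [ht.1]) ht1).le
  exact absurd (hmin _ htN) (not_le.2 ((hlt t (Ioo_subset_Icc_self ht) s hs).trans_le hle))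

/-- The images under `L` of a normalized minimizing sequence converge to some `L w`; comparing
levels along rays shows that `w ≠ 0` and that the ray through `w` stays below the infimum. -/
theorem RaysCrossDownward.exists_forall_le {G : Type*} [NormedAddCommGroup G] [NormedSpace ℝ G]
    (hcross : RaysCrossDownward J) (hJ : Differentiable ℝ J) (hne : (nehariSet J).Nonempty)
    (hproj : ∀ u ≠ 0, ∃ t : ℝ, 0 < t ∧ t • u ∈ nehariSet J) {A : ℝ → ℝ} (hA : MonotoneOn A (Ici 0))
    (hA' : Tendsto A atTop atTop) {Ψ : G → ℝ} (hΨ : Continuous Ψ) {L : E →L[ℝ] G}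
    (hL : IsCompact (L '' Metric.closedBall 0 1)) (hJL : ∀ u, J u = A ‖u‖ - Ψ (L u)) :
    ∃ u ∈ nehariSet J, ∀ v ∈ nehariSet J, J u ≤ J v := by
  have hray : ∀ v ∈ nehariSet J, ∀ s : ℝ, 0 ≤ s → J (s • v) ≤ J v := fun v hv s hs => by
    rcases eq_or_ne s 1 with rfl | hs1
    · rw [one_smul]
    · exact (hcross.apply_smul_lt hJ hv hs hs1).le
  have hbdd : BddBelow (J '' nehariSet J) := ⟨J 0, forall_mem_image.2 fun v hv => by
    simpa using hray v hv 0 le_rfl⟩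
  obtain ⟨_, -, hlim, hmem⟩ := exists_seq_tendsto_sInf (hne.image J) hbdd
  choose v hv hvJ using hmem
  replace hlim := hlim.congr fun n => (hvJ n).symm
  set m := sInf (J '' nehariSet J)
  have hnorm : ∀ n, 0 < ‖v n‖ := fun n => norm_pos_iff.2 (hv n).1
  obtain ⟨_, ⟨w, hw, rfl⟩, k, hk, hLw⟩ := hL.tendsto_subseq fun n =>
    mem_image_of_mem L (show ‖v n‖⁻¹ • v n ∈ Metric.closedBall 0 1 by
      simp [norm_smul, (hnorm n).ne'])
  have hlevel : ∀ s : ℝ, 0 ≤ s → A s - Ψ (s • L w) ≤ m := fun s hs => by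
    refine le_of_tendsto_of_tendsto' (tendsto_const_nhds.sub
      ((hΨ.tendsto _).comp (hLw.const_smul s))) (hlim.comp hk.tendsto_atTop) fun n => ?_
    have := hray _ (hv (k n)) (s * ‖v (k n)‖⁻¹) (by positivity)
    rwa [mul_smul, hJL, norm_smul, norm_smul, norm_inv, norm_norm,
      inv_mul_cancel₀ (hnorm _).ne', mul_one, Real.norm_of_nonneg hs, map_smul] at this
  have hw0 : w ≠ 0 := by
    rintro rfl
    obtain ⟨s, hs, hs0⟩ := ((hA'.eventually_gt_atTop (m + Ψ 0)).and (eventually_ge_atTop 0)).exists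
    have := hlevel s hs0
    rw [map_zero, smul_zero] at this
    linarith
  obtain ⟨t, ht, htw⟩ := hproj w hw0
  refine ⟨t • w, htw, fun u hu => le_trans ?_ (csInf_le hbdd (mem_image_of_mem J hu))⟩
  refine le_trans ?_ (hlevel t ht.le)
  rw [hJL, map_smul, norm_smul, Real.norm_of_nonneg ht.le]
  refine sub_le_sub_right (hA (by positivity : 0 ≤ t * ‖w‖) ht.le ?_) _
  exact mul_le_of_le_one_right ht.le (mem_closedBall_zero_iff.1 hw)

theorem monotoneOn_div_rpow {g g' : ℝ → ℝ} {θ : ℝ} (hg : ∀ t, HasDerivAt g (g' t) t)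
    (hθ : ∀ t > 0, θ * g t ≤ t * g' t) : MonotoneOn (fun t => g t / t ^ θ) (Ioi 0) := by
  have hderiv : ∀ t > 0, HasDerivAt (fun t => g t / t ^ θ)
      ((g' t * t ^ θ - g t * (θ * t ^ (θ - 1))) / (t ^ θ) ^ 2) t := fun t ht =>
    (hg t).div (Real.hasDerivAt_rpow_const (.inl ht.ne')) (Real.rpow_pos_of_pos ht θ).ne'
  refine monotoneOn_of_deriv_nonneg (convex_Ioi 0)
    (fun t ht => (hderiv t ht).continuousAt.continuousWithinAt)
    (fun t ht => (hderiv t (interior_subset ht)).differentiableAt.differentiableWithinAt)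
    fun t ht => ?_
  have ht : 0 < t := interior_subset ht
  rw [(hderiv t ht).deriv]
  have hpow : t ^ θ = t ^ (θ - 1) * t := by rw [← Real.rpow_add_one ht.ne', sub_add_cancel]
  have hfactor : g' t * t ^ θ - g t * (θ * t ^ (θ - 1)) = t ^ (θ - 1) * (t * g' t - θ * g t) := by
    rw [hpow]
    ring
  rw [hfactor]
  exact div_nonneg (mul_nonneg (by positivity) (sub_nonneg.2 (hθ t ht))) (by positivity)

theorem eventually_lt_mul_rpow {g : ℝ → ℝ} {a p θ : ℝ} (ha : 0 < a) (hpθ : p < θ)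
    (hg : MonotoneOn (fun t => g t / t ^ θ) (Ioi 0)) : ∀ᶠ t in 𝓝[>] 0, g t < a * t ^ p := by
  have hlim : Tendsto (fun t : ℝ => g 1 * t ^ (θ - p)) (𝓝[>] 0) (𝓝 0) := by
    have : Continuous fun t : ℝ => g 1 * t ^ (θ - p) :=
      continuous_const.mul (Real.continuous_rpow_const (by linarith))
    exact (this.tendsto' _ _ (by rw [Real.zero_rpow (by linarith), mul_zero])).mono_left
      nhdsWithin_le_nhds
  filter_upwards [hlim.eventually_lt_const ha, Ioo_mem_nhdsGT one_pos] with t ht ⟨ht0, ht1⟩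
  have hle : g t / t ^ θ ≤ g 1 := by simpa using hg (mem_Ioi.2 ht0) (mem_Ioi.2 one_pos) ht1.le
  rw [div_le_iff₀ (by positivity)] at hle
  rw [Real.rpow_sub ht0, ← mul_div_assoc, div_lt_iff₀ (by positivity)] at ht
  exact hle.trans_lt ht

theorem eventually_mul_rpow_lt {g : ℝ → ℝ} {p θ : ℝ} (a : ℝ) (hpθ : p < θ) (hg1 : 0 < g 1)
    (hg : MonotoneOn (fun t => g t / t ^ θ) (Ioi 0)) : ∀ᶠ t in atTop, a * t ^ p < g t := by
  have hlim : Tendsto (fun t : ℝ => g 1 * t ^ (θ - p)) atTop atTop :=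
    (tendsto_rpow_atTop (by linarith)).const_mul_atTop hg1
  filter_upwards [hlim.eventually_gt_atTop a, eventually_gt_atTop 1] with t ht ht1
  have ht0 : 0 < t := one_pos.trans ht1
  have hle : g 1 ≤ g t / t ^ θ := by simpa using hg (mem_Ioi.2 one_pos) (mem_Ioi.2 ht0) ht1.le
  rw [le_div_iff₀ (by positivity)] at hle
  rw [Real.rpow_sub ht0, ← mul_div_assoc, lt_div_iff₀ (by positivity)] at ht
  exact ht.trans_le hle

/-- A superhomogeneous term of degree `θ > p` is negligible near the origin and dominates at
infinity along every ray, so every ray meets the Nehari set. -/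
theorem exists_pos_smul_mem_nehariSet {p θ : ℝ} (hp : 0 < p) (hpθ : p < θ) {I : E → ℝ}
    (hI : Differentiable ℝ I) (hJ : Differentiable ℝ J) (hJI : ∀ u, J u = 1 / p * ‖u‖ ^ p - I u)
    (hI0 : I 0 = 0) (hIpos : ∀ u ≠ 0, 0 < I u) (hθ : ∀ u, θ * I u ≤ fderiv ℝ I u u) {u : E}
    (hu : u ≠ 0) : ∃ t : ℝ, 0 < t ∧ t • u ∈ nehariSet J := by
  have hmono : MonotoneOn (fun t : ℝ => I (t • u) / t ^ θ) (Ioi 0) :=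
    monotoneOn_div_rpow (hasDerivAt_ray hI u) fun t _ => by
      simpa only [map_smul, smul_eq_mul] using hθ (t • u)
  have hJ0 : J 0 = 0 := by simp [hJI, hI0, Real.zero_rpow hp.ne']
  have hJt : ∀ t : ℝ, 0 < t → J (t • u) = 1 / p * ‖u‖ ^ p * t ^ p - I (t • u) := fun t ht => by
    rw [hJI, norm_smul, Real.norm_of_nonneg ht.le, Real.mul_rpow ht.le (norm_nonneg u)]
    ring
  obtain ⟨c, hc, hc0⟩ := ((eventually_lt_mul_rpow (a := 1 / p * ‖u‖ ^ p) (by positivity) hpθ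
    hmono).and self_mem_nhdsWithin).exists
  obtain ⟨b, hb, hcb⟩ := ((eventually_mul_rpow_lt (1 / p * ‖u‖ ^ p) hpθ
    (by simpa using hIpos u hu) hmono).and (eventually_ge_atTop c)).exists
  have hc0 : 0 < c := hc0
  have hJc : 0 < J (c • u) := by rw [hJt c hc0]; exact sub_pos.2 hc
  have hJb : J (b • u) < 0 := by rw [hJt b (hc0.trans_le hcb)]; exact sub_neg.2 hb
  obtain ⟨t, ht, htN⟩ := exists_smul_mem_nehariSet hJ hu le_rfl ⟨hc0.le, hcb⟩
    (by rwa [zero_smul, hJ0]) (hJb.trans hJc)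
  exact ⟨t, ht.1, htN⟩

end Nehari

/-! ### The lattice graph -/

section Lattice

variable {N : ℕ}

theorem latticeGraph_adj {x y : Fin N → ℤ} :
    (latticeGraph N).Adj x y ↔ ∑ i, |x i - y i| = 1 := Iff.rfl

/-- The unit vectors `± e_i`, i.e. the neighbors of the origin: the neighbors of `x` are the points
`x + e` with `e` in this set. -/
abbrev unitSteps (N : ℕ) : Finset (Fin N → ℤ) := (latticeGraph N).neighborFinset 0

theorem mem_neighborFinset_iff_sub_mem_unitSteps {x y : Fin N → ℤ} :
    y ∈ (latticeGraph N).neighborFinset x ↔ y - x ∈ unitSteps N := by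
  simp [latticeGraph_adj]

theorem sum_neighborFinset {M : Type*} [AddCommMonoid M] (g : (Fin N → ℤ) → M) (x : Fin N → ℤ) :
    ∑ y ∈ (latticeGraph N).neighborFinset x, g y = ∑ e ∈ unitSteps N, g (x + e) :=
  Finset.sum_bij' (fun y _ => y - x) (fun e _ => x + e)
    (fun _ hy => mem_neighborFinset_iff_sub_mem_unitSteps.1 hy)
    (fun _ he => mem_neighborFinset_iff_sub_mem_unitSteps.2 (by rwa [add_sub_cancel_left]))
    (by simp) (by simp) (by simp)

theorem latticeGraph_preconnected : (latticeGraph N).Preconnected := by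
  let S : AddSubgroup (Fin N → ℤ) :=
    { carrier := {v | ∀ x, (latticeGraph N).Reachable x (x + v)}
      zero_mem' := fun x => by rw [add_zero]
      add_mem' := fun {v w} hv hw x => by rw [← add_assoc]; exact (hv x).trans (hw _)
      neg_mem' := fun {v} hv x => by simpa using (hv (x + -v)).symm }
  have hS : ∀ i, Pi.single i 1 ∈ S := fun i x => SimpleGraph.Adj.reachable <| by
    simp only [latticeGraph_adj, Pi.add_apply, sub_add_cancel_left, abs_neg]
    rw [Finset.sum_eq_single i (fun j _ hj => by simp [hj]) (by simp), Pi.single_eq_same, abs_one]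
  intro x y
  have hxy : y - x ∈ S := by
    rw [← Finset.univ_sum_single (y - x)]
    refine sum_mem fun i _ => ?_
    rw [← mul_one ((y - x) i), ← smul_eq_mul, Pi.single_smul]
    exact zsmul_mem (hS i) _
  simpa using hxy x

theorem sum_abs_sub_le_length {x y : Fin N → ℤ} (w : (latticeGraph N).Walk x y) :
    ∑ i, |x i - y i| ≤ w.length := by
  induction w with
  | nil => simp
  | @cons a b c hab w ih =>
    calc ∑ i, |a i - c i| ≤ ∑ i, (|a i - b i| + |b i - c i|) :=
          Finset.sum_le_sum fun i _ => abs_sub_le _ _ _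
      _ ≤ (SimpleGraph.Walk.cons hab w).length := by
          rw [Finset.sum_add_distrib, latticeGraph_adj.1 hab, SimpleGraph.Walk.length_cons]
          push_cast
          linarith

theorem finite_setOf_dist_le (x₀ : Fin N → ℤ) (n : ℕ) :
    {x | (latticeGraph N).dist x x₀ ≤ n}.Finite := by
  refine (finite_Icc (x₀ - fun _ => (n : ℤ)) (x₀ + fun _ => (n : ℤ))).subset fun x hx => ?_
  obtain ⟨w, hw⟩ := (latticeGraph_preconnected x x₀).exists_walk_length_eq_dist
  have hlen : (w.length : ℤ) ≤ n := by rw [hw]; exact_mod_cast hx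
  have hcoord : ∀ i, |x i - x₀ i| ≤ n := fun i =>
    (Finset.single_le_sum (fun j _ => abs_nonneg (x j - x₀ j)) (Finset.mem_univ i)).trans
      ((sum_abs_sub_le_length w).trans hlen)
  exact ⟨fun i => sub_le_of_abs_sub_le_left (hcoord i), fun i => by
    simpa [add_comm] using sub_le_iff_le_add.1 (abs_sub_le_iff.1 (hcoord i)).1⟩

theorem tendsto_dist_cofinite (x₀ : Fin N → ℤ) :
    Tendsto (fun x => (latticeGraph N).dist x x₀) cofinite atTop :=
  tendsto_atTop.2 fun n => by
    filter_upwards [(finite_setOf_dist_le x₀ n).compl_mem_cofinite] with x hx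
    exact (not_le.1 (notMem_ofPred_iff.1 hx)).le

end Lattice

/-! ### Functions in `ℓ^p` belong to `W^{1,p}` -/

section MemW1p

variable {N : ℕ} {p : ℝ}

theorem gradLen_le_sum (u : (Fin N → ℤ) → ℝ) (x : Fin N → ℤ) :
    gradLen u x ≤ ∑ e ∈ unitSteps N, |u (x + e) - u x| := by
  refine Real.sqrt_le_iff.2 ⟨by positivity, ?_⟩
  have hsq : ∑ e ∈ unitSteps N, |u (x + e) - u x| ^ 2 ≤
      (∑ e ∈ unitSteps N, |u (x + e) - u x|) ^ 2 :=
    Finset.sum_sq_le_sq_sum_of_nonneg fun _ _ => abs_nonneg _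
  rw [gradForm, sum_neighborFinset]
  simp only [sq_abs] at hsq
  simp only [← sq]
  linarith [Finset.sum_nonneg fun e (_ : e ∈ unitSteps N) => sq_nonneg (u (x + e) - u x)]

theorem energyDensity_one_le (hp : 2 ≤ p) (u : (Fin N → ℤ) → ℝ) (x : Fin N → ℤ) :
    energyDensity p (fun _ => 1) u x ≤ ((unitSteps N).card : ℝ) ^ (p - 1) *
      ∑ e ∈ unitSteps N, 2 ^ p * (|u (x + e)| ^ p + |u x| ^ p) + |u x| ^ p := by
  have hp0 : 0 ≤ p := by linarith
  rw [energyDensity, one_mul]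
  refine add_le_add_left ?_ _
  calc gradLen u x ^ p ≤ (∑ e ∈ unitSteps N, |u (x + e) - u x|) ^ p :=
        Real.rpow_le_rpow (gradLen_nonneg u x) (gradLen_le_sum u x) hp0
    _ ≤ ((unitSteps N).card : ℝ) ^ (p - 1) * ∑ e ∈ unitSteps N, |u (x + e) - u x| ^ p :=
        Real.rpow_sum_le_const_mul_sum_rpow _ _ (by linarith)
    _ ≤ _ := by
        gcongr with e
        exact (Real.rpow_le_rpow (abs_nonneg _) (abs_sub _ _) hp0).trans
          (add_rpow_le_two_rpow_mul (abs_nonneg _) (abs_nonneg _) hp0)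

theorem exists_summable_bound_energyDensity_one (hp : 2 ≤ p) {u : (Fin N → ℤ) → ℝ}
    (hu : Summable fun x => |u x| ^ p) : ∃ b : (Fin N → ℤ) → ℝ, Summable b ∧
      ∀ v, (∀ x, |v x| ≤ |u x|) → ∀ x, energyDensity p (fun _ => 1) v x ≤ b x := by
  have : 0 ≤ p := by linarith
  have hshift : ∀ e, Summable fun x => |u (x + e)| ^ p := fun e =>
    (Equiv.addRight e).summable_iff.2 hu
  exact ⟨_, ((summable_sum fun e (_ : e ∈ unitSteps N) => ((hshift e).add hu).mul_left
    (2 ^ p)).mul_left (((unitSteps N).card : ℝ) ^ (p - 1))).add hu, fun v hv x =>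
      (energyDensity_one_le hp v x).trans (by
        gcongr _ * ∑ e ∈ _, _ * (?_ ^ p + ?_ ^ p) + ?_ ^ p <;> exact hv _)⟩

theorem tendsto_energyDensity_sub_indicator (hp : 2 ≤ p) (h u : (Fin N → ℤ) → ℝ)
    (x : Fin N → ℤ) : Tendsto (fun s : Finset (Fin N → ℤ) =>
      energyDensity p h (u - (s : Set (Fin N → ℤ)).indicator u) x) atTop (𝓝 0) := by
  refine tendsto_const_nhds.congr' ?_
  filter_upwards [eventually_ge_atTop (insert x ((latticeGraph N).neighborFinset x))] with s hs
  have hzero : ∀ y ∈ insert x ((latticeGraph N).neighborFinset x),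
      (u - (s : Set (Fin N → ℤ)).indicator u) y = 0 := fun y hy => by
    rw [Pi.sub_apply, indicator_of_mem (Finset.mem_coe.2 (hs hy)), sub_self]
  have hp0 : p ≠ 0 := by linarith
  have hgrad : gradForm (u - (s : Set (Fin N → ℤ)).indicator u)
      (u - (s : Set (Fin N → ℤ)).indicator u) x = 0 := by
    rw [gradForm, Finset.sum_eq_zero fun y hy => by
      rw [hzero y (Finset.mem_insert_of_mem hy), hzero x (Finset.mem_insert_self _ _)]
      ring, mul_zero]
  rw [energyDensity, gradLen, hgrad, hzero x (Finset.mem_insert_self _ _), abs_zero,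
    Real.sqrt_zero, Real.zero_rpow hp0, mul_zero, add_zero]

theorem MemW1p.of_summable (hp : 2 ≤ p) {u : (Fin N → ℤ) → ℝ} (hu : Summable fun x => |u x| ^ p) :
    MemW1p p u := by
  have hp0 : 0 < p := by linarith
  obtain ⟨b, hb, hle⟩ := exists_summable_bound_energyDensity_one hp hu
  have hnonneg := fun v => energyDensity_nonneg p (fun _ : Fin N → ℤ => zero_le_one) v
  refine ⟨hb.of_nonneg_of_le (hnonneg u) (hle u fun _ => le_rfl), fun ε hε => ?_⟩
  have hlim := tendsto_tsum_of_dominated_convergence hb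
    (tendsto_energyDensity_sub_indicator hp (fun _ => 1) u) (.of_forall fun s x => by
      rw [Real.norm_of_nonneg (hnonneg _ x)]
      refine hle _ (fun y => ?_) x
      rw [← indicator_compl]
      exact norm_indicator_le_norm_self u y)
  rw [tsum_zero] at hlim
  obtain ⟨s, hs⟩ := (hlim.eventually_lt_const (Real.rpow_pos_of_pos hε p)).exists
  refine ⟨(s : Set (Fin N → ℤ)).indicator u, s.finite_toSet.subset support_indicator_subset, ?_⟩
  rw [energyNorm, one_div, Real.rpow_inv_lt_iff_of_pos (tsum_nonneg (hnonneg _)) hε.le hp0]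
  exact hs

end MemW1p

/-! ### The norm of `H` -/

section LpNorm

open scoped ENNReal InnerProductSpace

variable {ι V : Type*} {P : ℝ≥0∞} [Fact (1 ≤ P)] [NormedAddCommGroup V]

theorem exists_hasStrictFDerivAt_lp_norm_rpow [InnerProductSpace ℝ V] (hP : 1 < P.toReal)
    (u : lp (fun _ : ι => V) P) :
    ∃ D : lp (fun _ : ι => V) P →L[ℝ] ℝ, HasStrictFDerivAt (fun w => ‖w‖ ^ P.toReal) D u ∧
      ∀ w, D w = P.toReal * ∑' i, ‖u i‖ ^ (P.toReal - 2) * ⟪u i, w i⟫_ℝ := by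
  have hP0 := zero_lt_one.trans hP
  have hderiv := fun a : V => hasFDerivAt_norm_rpow a hP
  have hcont : Continuous fun a : V => (P.toReal * ‖a‖ ^ (P.toReal - 2)) • innerSL ℝ a := by
    rw [← funext fun a : V => fderiv_norm_rpow a hP]
    exact (contDiff_norm_rpow hP).continuous_fderiv one_ne_zero
  have hgrowth' : PowerGrowth (fun a : V => (P.toReal * ‖a‖ ^ (P.toReal - 2)) • innerSL ℝ a)
      (P.toReal - 1) := fun _ => ⟨P.toReal, hP0.le, fun a _ => by
    beta_reduce
    rw [← fderiv_norm_rpow a hP, norm_fderiv_norm_id_rpow a hP]⟩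
  have hgrowth : PowerGrowth (fun a : V => ‖a‖ ^ P.toReal) (P.toReal / (1 : ℝ≥0∞).toReal) := by
    simpa only [ENNReal.toReal_one, div_one, sub_add_cancel] using
      PowerGrowth.of_fderiv (sub_nonneg.2 hP.le) (by rw [norm_zero, Real.zero_rpow hP0.ne'])
        hderiv hgrowth'
  obtain ⟨D, hD, hDw⟩ := exists_hasStrictFDerivAt_superposition hderiv hcont hP hgrowth hgrowth' u
  refine ⟨lp.tsumCLM ℝ ι ℝ ∘L D, ?_, fun w => ?_⟩
  · simp_rw [lp.norm_rpow_eq_tsum hP0]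
    exact (lp.tsumCLM ℝ ι ℝ).hasStrictFDerivAt.comp u hD
  · rw [← tsum_mul_left]
    exact tsum_congr fun i => (hDw w i).trans (mul_assoc _ _ _)

/-- The continuous linear map into `ℓ^p` given by a linear map into functions that satisfies a norm
bound. -/
def toLpOfBound {E : Type*} [NormedAddCommGroup E] [NormedSpace ℝ E] [NormedSpace ℝ V]
    (hP : 0 < P.toReal) (T : E →ₗ[ℝ] ι → V)
    (hT : ∃ C, 0 ≤ C ∧ ∀ u, ∀ s : Finset ι, ∑ i ∈ s, ‖T u i‖ ^ P.toReal ≤ (C * ‖u‖) ^ P.toReal) :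
    E →L[ℝ] lp (fun _ : ι => V) P :=
  LinearMap.mkContinuousOfExistsBound
    { toFun u := ⟨T u, memℓp_gen' (hT.choose_spec.2 u)⟩
      map_add' u v := Subtype.ext (map_add T u v)
      map_smul' c u := Subtype.ext (map_smul T c u) }
    ⟨hT.choose, fun u => lp.norm_le_of_forall_sum_le hP
      (mul_nonneg hT.choose_spec.1 (norm_nonneg u)) (hT.choose_spec.2 u)⟩

end LpNorm

section Space

open scoped ENNReal InnerProductSpace

variable {N : ℕ} {p : ℝ} {h : (Fin N → ℤ) → ℝ} {hp : 2 ≤ p} {hh : BoundedBelow h}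

/-- The discrete gradient as a vector, normalized so that its length is `gradLen`. -/
def gradVec : ((Fin N → ℤ) → ℝ) →ₗ[ℝ] (Fin N → ℤ) → EuclideanSpace ℝ (unitSteps N) where
  toFun u x := WithLp.toLp 2 fun e => (√2)⁻¹ * (u (x + e) - u x)
  map_add' u v := by
    ext x e
    simp only [Pi.add_apply, PiLp.add_apply]
    ring
  map_smul' c u := by
    ext x e
    simp only [Pi.smul_apply, PiLp.smul_apply, smul_eq_mul, RingHom.id_apply]
    ring

theorem inner_gradVec (u v : (Fin N → ℤ) → ℝ) (x : Fin N → ℤ) :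
    ⟪gradVec u x, gradVec v x⟫_ℝ = gradForm u v x := by
  have h2 : (√2 : ℝ)⁻¹ * (√2)⁻¹ = 1 / 2 := by
    rw [← mul_inv, Real.mul_self_sqrt zero_le_two, one_div]
  rw [gradForm, sum_neighborFinset, Finset.mul_sum, ← Finset.sum_coe_sort, PiLp.inner_apply]
  refine Finset.sum_congr rfl fun e _ => ?_
  rw [← h2, RCLike.inner_apply, conj_trivial]
  simp only [gradVec, LinearMap.coe_mk, AddHom.coe_mk]
  ring

theorem norm_gradVec (u : (Fin N → ℤ) → ℝ) (x : Fin N → ℤ) : ‖gradVec u x‖ = gradLen u x := by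
  rw [norm_eq_sqrt_real_inner, inner_gradVec, gradLen]

/-- The derivative of `u ↦ (1 / p) ∑ (|∇u|^p + h |u|^p)` at `u` in the direction `w`. -/
def dirichletForm (p : ℝ) (h u w : (Fin N → ℤ) → ℝ) : ℝ :=
  ∑' x, gradLen u x ^ (p - 2) * gradForm u w x + ∑' x, h x * |u x| ^ (p - 2) * u x * w x

theorem BoundedBelow.pos (hh : BoundedBelow h) (x : Fin N → ℤ) : 0 < h x :=
  hh.elim fun _ h₀ => h₀.1.trans_le (h₀.2 x)

theorem norm_rpow_inv_mul_rpow (hp : 2 ≤ p) {a : ℝ} (ha : 0 ≤ a) (b : ℝ) :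
    ‖a ^ p⁻¹ * b‖ ^ p = a * |b| ^ p := by
  rw [norm_mul, Real.norm_of_nonneg (by positivity), Real.norm_eq_abs,
    Real.mul_rpow (by positivity) (abs_nonneg b), Real.rpow_inv_rpow ha (by linarith)]

theorem norm_rpow_inv_mul_rpow_sub_two_mul (hp : 2 ≤ p) {a : ℝ} (ha : 0 < a) (b c : ℝ) :
    ‖a ^ p⁻¹ * b‖ ^ (p - 2) * ((a ^ p⁻¹ * c) * (a ^ p⁻¹ * b)) = a * |b| ^ (p - 2) * b * c := by
  have hr : 0 < a ^ p⁻¹ := Real.rpow_pos_of_pos ha _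
  have hpow : (a ^ p⁻¹) ^ (p - 2) * (a ^ p⁻¹) ^ 2 = a := by
    rw [← Real.rpow_two, ← Real.rpow_add hr, sub_add_cancel,
      Real.rpow_inv_rpow ha.le (by linarith)]
  rw [norm_mul, Real.norm_of_nonneg hr.le, Real.norm_eq_abs, Real.mul_rpow hr.le (abs_nonneg b)]
  linear_combination |b| ^ (p - 2) * b * c * hpow

namespace HSpace

theorem norm_rpow (u : HSpace p h hp hh) : ‖u‖ ^ p = ∑' x, energyDensity p h u x := by
  change ((∑' x, energyDensity p h u x) ^ (1 / p)) ^ p = _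
  rw [one_div, Real.rpow_inv_rpow (tsum_nonneg (energyDensity_nonneg p hh.nonneg _))
    (by linarith)]

theorem sum_energyDensity_le (u : HSpace p h hp hh) (s : Finset (Fin N → ℤ)) :
    ∑ x ∈ s, energyDensity p h u x ≤ ‖u‖ ^ p :=
  (u.summable.sum_le_tsum s fun x _ => energyDensity_nonneg p hh.nonneg _ x).trans_eq
    u.norm_rpow.symm

/-- The inclusion of `H` into the space of all functions. -/
def coeₗ : HSpace p h hp hh →ₗ[ℝ] (Fin N → ℤ) → ℝ := (HSubmodule p h hp hh).subtype

theorem toReal_ofReal (hp : 2 ≤ p) : (ENNReal.ofReal p).toReal = p :=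
  ENNReal.toReal_ofReal (by linarith)

theorem toReal_ofReal_pos (hp : 2 ≤ p) : 0 < (ENNReal.ofReal p).toReal := by
  rw [toReal_ofReal hp]
  linarith

/-- A bound by the energy density turns a linear map on functions into a bounded operator. -/
theorem exists_bound {V : Type*} [NormedAddCommGroup V] [NormedSpace ℝ V]
    (T : HSpace p h hp hh →ₗ[ℝ] (Fin N → ℤ) → V) {c : ℝ} (hc : 0 ≤ c)
    (hT : ∀ u x, ‖T u x‖ ^ p ≤ c * energyDensity p h u x) :
    ∃ C, 0 ≤ C ∧ ∀ u, ∀ s : Finset (Fin N → ℤ),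
      ∑ x ∈ s, ‖T u x‖ ^ (ENNReal.ofReal p).toReal ≤ (C * ‖u‖) ^ (ENNReal.ofReal p).toReal := by
  refine ⟨c ^ p⁻¹, by positivity, fun u s => ?_⟩
  rw [toReal_ofReal hp, Real.mul_rpow (by positivity) (norm_nonneg u),
    Real.rpow_inv_rpow hc (by linarith)]
  calc ∑ x ∈ s, ‖T u x‖ ^ p ≤ ∑ x ∈ s, c * energyDensity p h u x :=
        Finset.sum_le_sum fun x _ => hT u x
    _ ≤ c * ‖u‖ ^ p := by
        rw [← Finset.mul_sum]
        exact mul_le_mul_of_nonneg_left (u.sum_energyDensity_le s) hc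

theorem gradLen_rpow_le (u : HSpace p h hp hh) (x : Fin N → ℤ) :
    gradLen u x ^ p ≤ energyDensity p h u x :=
  le_add_of_nonneg_right (mul_nonneg (hh.nonneg x) (by positivity))

theorem potential_mul_le (u : HSpace p h hp hh) (x : Fin N → ℤ) :
    h x * |u x| ^ p ≤ energyDensity p h u x :=
  le_add_of_nonneg_left (Real.rpow_nonneg (gradLen_nonneg _ x) p)

variable [Fact (1 ≤ ENNReal.ofReal p)]

/-- The gradient as an operator from `H` to `ℓ^p`. -/
def grad : HSpace p h hp hh →L[ℝ]
    lp (fun _ : Fin N → ℤ => EuclideanSpace ℝ (unitSteps N)) (ENNReal.ofReal p) :=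
  toLpOfBound (toReal_ofReal_pos hp) (gradVec ∘ₗ coeₗ) <|
    exists_bound _ zero_le_one fun u x => by
      rw [one_mul]
      exact (congrArg (· ^ p) (norm_gradVec _ x)).trans_le (gradLen_rpow_le u x)

/-- The operator `u ↦ h ^ (1 / p) u` from `H` to `ℓ^p`. -/
def weighted : HSpace p h hp hh →L[ℝ] lp (fun _ : Fin N → ℤ => ℝ) (ENNReal.ofReal p) :=
  toLpOfBound (toReal_ofReal_pos hp) (LinearMap.mulLeft ℝ (fun x => h x ^ p⁻¹) ∘ₗ coeₗ) <|
    exists_bound _ zero_le_one fun u x => by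
      rw [one_mul]
      exact (norm_rpow_inv_mul_rpow hp (hh.nonneg x) _).trans_le (potential_mul_le u x)

/-- The embedding of `H` into `ℓ^p`. -/
def toLp : HSpace p h hp hh →L[ℝ] lp (fun _ : Fin N → ℤ => ℝ) (ENNReal.ofReal p) :=
  toLpOfBound (toReal_ofReal_pos hp) coeₗ <| by
    obtain ⟨h₀, hpos, hle⟩ := id hh
    refine exists_bound _ (inv_nonneg.2 hpos.le) fun u x => ?_
    rw [inv_mul_eq_div, le_div_iff₀' hpos]
    exact (mul_le_mul_of_nonneg_right (hle x) (by positivity)).trans (potential_mul_le u x)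

theorem norm_rpow_eq_grad_add_weighted (u : HSpace p h hp hh) :
    ‖u‖ ^ p = ‖grad u‖ ^ p + ‖weighted u‖ ^ p := by
  have hsum := (summable_energyDensity_iff hh.nonneg _).1 u.summable
  have hgrad : ∀ x, ‖grad u x‖ ^ p = gradLen u x ^ p := fun x =>
    congrArg (· ^ p) (norm_gradVec _ x)
  have hweighted : ∀ x, ‖weighted u x‖ ^ p = h x * |u x| ^ p := fun x =>
    norm_rpow_inv_mul_rpow hp (hh.nonneg x) _
  have hlp := fun (V : Type) [NormedAddCommGroup V] =>
    lp.norm_rpow_eq_tsum (E := fun _ : Fin N → ℤ => V) (toReal_ofReal_pos hp)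
  simp only [toReal_ofReal hp] at hlp
  rw [norm_rpow, hlp, hlp, tsum_congr hgrad, tsum_congr hweighted]
  exact hsum.1.tsum_add hsum.2

theorem exists_hasStrictFDerivAt_norm_rpow (u : HSpace p h hp hh) :
    ∃ D : HSpace p h hp hh →L[ℝ] ℝ, HasStrictFDerivAt (fun w => ‖w‖ ^ p) D u ∧
      ∀ w, D w = p * dirichletForm p h u w := by
  have hP : 1 < (ENNReal.ofReal p).toReal := by rw [toReal_ofReal hp]; linarith
  obtain ⟨D₁, hD₁, hD₁w⟩ := exists_hasStrictFDerivAt_lp_norm_rpow hP (grad u)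
  obtain ⟨D₂, hD₂, hD₂w⟩ := exists_hasStrictFDerivAt_lp_norm_rpow hP (weighted u)
  simp only [toReal_ofReal hp] at hD₁ hD₁w hD₂ hD₂w
  refine ⟨D₁ ∘L grad + D₂ ∘L weighted, ?_, fun w => ?_⟩
  · simp_rw [norm_rpow_eq_grad_add_weighted]
    exact (hD₁.comp u grad.hasStrictFDerivAt).add (hD₂.comp u weighted.hasStrictFDerivAt)
  · change D₁ (grad w) + D₂ (weighted w) = _
    rw [hD₁w, hD₂w, dirichletForm, mul_add]
    congr 2
    · exact tsum_congr fun x => congrArg₂ (fun a b => a ^ (p - 2) * b)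
        (norm_gradVec u x) (inner_gradVec u w x)
    · exact tsum_congr fun x => norm_rpow_inv_mul_rpow_sub_two_mul hp (hh.pos x) (u x) (w x)

end HSpace

end Space

/-! ### Compactness of the embedding of `H` into `ℓ^p` -/

section Compactness

open scoped ENNReal

variable {N : ℕ} {p : ℝ} {h : (Fin N → ℤ) → ℝ} {hp : 2 ≤ p} {hh : BoundedBelow h}

theorem continuous_energyDensity (hp : 2 ≤ p) (h : (Fin N → ℤ) → ℝ) (x : Fin N → ℤ) :
    Continuous fun u => energyDensity p h u x := by
  have hp0 : 0 ≤ p := by linarith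
  have hgrad : Continuous fun u : (Fin N → ℤ) → ℝ => gradLen u x := by
    unfold gradLen gradForm
    fun_prop
  exact (hgrad.rpow_const fun _ => .inr hp0).add
    (continuous_const.mul ((continuous_apply x).abs.rpow_const fun _ => .inr hp0))

namespace HSpace

/-- A function of finite energy as an element of `H`. -/
def ofSummable (hp : 2 ≤ p) (hh : BoundedBelow h) (u : (Fin N → ℤ) → ℝ)
    (hu : Summable (energyDensity p h u)) : HSpace p h hp hh :=
  have hpot := ((summable_energyDensity_iff hh.nonneg u).1 hu).2
  ⟨u, MemW1p.of_summable hp <| by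
    obtain ⟨h₀, hpos, hle⟩ := hh
    refine .of_nonneg_of_le (fun x => by positivity) (fun x => ?_) (hpot.mul_left h₀⁻¹)
    rw [inv_mul_eq_div, le_div_iff₀' hpos]
    exact mul_le_mul_of_nonneg_right (hle x) (by positivity), hpot⟩

/-- The functions of energy at most one; the condition is stated for finite sums to make it closed
under pointwise convergence. -/
def energyBall (p : ℝ) (h : (Fin N → ℤ) → ℝ) : Set ((Fin N → ℤ) → ℝ) :=
  {u | ∀ s : Finset (Fin N → ℤ), ∑ x ∈ s, energyDensity p h u x ≤ 1}

theorem isCompact_energyBall (hp : 2 ≤ p) (hh : BoundedBelow h) : IsCompact (energyBall p h) := by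
  have hp0 : 0 < p := by linarith
  have hclosed : IsClosed (energyBall p h) := by
    rw [energyBall, ofPred_forall]
    exact isClosed_iInter fun s => isClosed_le
      (continuous_finsetSum s fun x _ => continuous_energyDensity hp h x) continuous_const
  refine (isCompact_univ_pi fun x => isCompact_Icc).of_isClosed_subset hclosed
    fun u hu x _ => abs_le.1 (?_ : |u x| ≤ (h x)⁻¹ ^ p⁻¹)
  have hle : energyDensity p h u x ≤ 1 := by simpa using hu {x}
  have hgrad : 0 ≤ gradLen u x ^ p := Real.rpow_nonneg (gradLen_nonneg u x) p
  rw [Real.le_rpow_inv_iff_of_pos (abs_nonneg _) (inv_nonneg.2 (hh.nonneg x)) hp0,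
    ← one_div, le_div_iff₀' (hh.pos x)]
  rw [energyDensity] at hle
  linarith

theorem summable_of_mem_energyBall (hh : BoundedBelow h) {u : (Fin N → ℤ) → ℝ}
    (hu : u ∈ energyBall p h) : Summable (energyDensity p h u) :=
  summable_of_sum_le (energyDensity_nonneg p hh.nonneg u) hu

/-- The element of `H` given by a function of energy at most one. -/
def ofEnergyBall (hp : 2 ≤ p) (hh : BoundedBelow h) (u : energyBall p h) : HSpace p h hp hh :=
  ofSummable hp hh u (summable_of_mem_energyBall hh u.2)

theorem range_ofEnergyBall :
    range (ofEnergyBall hp hh) = Metric.closedBall (0 : HSpace p h hp hh) 1 := by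
  have hp0 : 0 < p := by linarith
  have hball : ∀ u : HSpace p h hp hh, ‖u‖ ≤ 1 ↔ ‖u‖ ^ p ≤ 1 := fun u => by
    rw [← Real.rpow_le_rpow_iff (norm_nonneg u) zero_le_one hp0, Real.one_rpow]
  ext u
  rw [mem_closedBall_zero_iff, hball]
  constructor
  · rintro ⟨u, rfl⟩
    exact (norm_rpow _).trans_le ((summable_of_mem_energyBall hh u.2).tsum_le_of_sum_le u.2)
  · exact fun hu => ⟨⟨u, fun s => (u.sum_energyDensity_le s).trans hu⟩, rfl⟩

variable [Fact (1 ≤ ENNReal.ofReal p)]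

theorem norm_toLp_rpow_le (w : HSpace p h hp hh) {S : Finset (Fin N → ℤ)} {M : ℝ} (hM : 0 < M)
    (hS : ∀ x ∉ S, M ≤ h x) : ‖toLp w‖ ^ p ≤ ∑ x ∈ S, |w x| ^ p + ‖w‖ ^ p / M := by
  have hlp := lp.hasSum_norm (toReal_ofReal_pos hp) (toLp w)
  rw [toReal_ofReal hp] at hlp
  have hnorm : HasSum (fun x => energyDensity p h w x / M) (‖w‖ ^ p / M) := by
    rw [norm_rpow]
    exact w.summable.hasSum.div_const M
  refine hasSum_le (fun x => ?_) hlp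
    ((hasSum_subtype_iff_indicator.1 (S.hasSum fun x => |w x| ^ p)).add hnorm)
  have hpot := potential_mul_le w x
  have : 0 ≤ energyDensity p h w x := energyDensity_nonneg p hh.nonneg w x
  by_cases hx : x ∈ S
  · rw [indicator_of_mem (Finset.mem_coe.2 hx)]
    exact le_add_of_nonneg_right (by positivity)
  · rw [indicator_of_notMem (mt Finset.mem_coe.1 hx), zero_add, le_div_iff₀' hM]
    exact (mul_le_mul_of_nonneg_right (hS x hx) (by positivity)).trans hpot

theorem continuous_toLp_ofEnergyBall (hh_coercive : Tendsto h cofinite atTop) :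
    Continuous fun u => toLp (ofEnergyBall hp hh u) := by
  have hp0 : 0 < p := by linarith
  refine continuous_iff_continuousAt.2 fun u => Metric.tendsto_nhds.2 fun ε hε => ?_
  have hM : 0 < 2 * 2 ^ p / ε ^ p := by positivity
  have hfin : {x | ¬ 2 * 2 ^ p / ε ^ p ≤ h x}.Finite :=
    hh_coercive.eventually_ge_atTop (2 * 2 ^ p / ε ^ p)
  have hlim : Tendsto (fun v : energyBall p h =>
      ∑ x ∈ hfin.toFinset, |v.1 x - u.1 x| ^ p) (𝓝 u) (𝓝 0) := by
    have hcont : Continuous fun v : energyBall p h =>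
        ∑ x ∈ hfin.toFinset, |v.1 x - u.1 x| ^ p :=
      continuous_finsetSum _ fun x _ => (((continuous_apply x).comp
        continuous_subtype_val).sub continuous_const).abs.rpow_const fun _ => .inr hp0.le
    simpa [Real.zero_rpow hp0.ne'] using hcont.tendsto u
  filter_upwards [hlim.eventually_lt_const (show 0 < ε ^ p / 2 by positivity)] with v hv
  have hball : ∀ v, ‖ofEnergyBall hp hh v‖ ≤ 1 := fun v =>
    mem_closedBall_zero_iff.1 (range_ofEnergyBall.subset (mem_range_self v))
  have hsub : ‖ofEnergyBall hp hh v - ofEnergyBall hp hh u‖ ^ p ≤ 2 ^ p :=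
    Real.rpow_le_rpow (norm_nonneg _)
      ((norm_sub_le _ _).trans (by linarith [hball v, hball u])) hp0.le
  rw [dist_eq_norm, ← map_sub, ← Real.rpow_lt_rpow_iff (norm_nonneg _) hε.le hp0]
  calc _ ≤ _ := norm_toLp_rpow_le _ hM fun x hx => not_not.1 (mt hfin.mem_toFinset.2 hx)
    _ < ε ^ p / 2 + 2 ^ p / (2 * 2 ^ p / ε ^ p) :=
      add_lt_add_of_lt_of_le hv (div_le_div_of_nonneg_right hsub hM.le)
    _ = ε ^ p := by field_simp; ring

theorem isCompact_toLp_closedBall (hh_coercive : Tendsto h cofinite atTop) :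
    IsCompact (toLp '' Metric.closedBall (0 : HSpace p h hp hh) 1) := by
  have : CompactSpace (energyBall p h) := isCompact_iff_compactSpace.1 (isCompact_energyBall hp hh)
  rw [← range_ofEnergyBall, ← range_comp]
  exact isCompact_range (continuous_toLp_ofEnergyBall hh_coercive)

end HSpace

end Compactness

/-! ### The nonlocal term -/

section Nonlocal

open scoped ENNReal

theorem PowerGrowth.of_isBigO {f : ℝ → ℝ} {s : ℝ} (hf : Continuous f) (hs : 0 < s)
    (hf0 : f =O[𝓝[≠] 0] fun t => |t| ^ s) : PowerGrowth f s := fun r => by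
  have hlim : Tendsto (fun t : ℝ => |t| ^ s) (𝓝[≠] 0) (𝓝 0) := by
    have : Continuous fun t : ℝ => |t| ^ s := continuous_abs.rpow_const fun _ => .inr hs.le
    exact (this.tendsto' 0 0 (by simp [hs.ne'])).mono_left nhdsWithin_le_nhds
  have hzero : f 0 = 0 :=
    tendsto_nhds_unique (hf.continuousAt.tendsto.mono_left nhdsWithin_le_nhds)
      (hf0.trans_tendsto hlim)
  obtain ⟨C, hC, hCf⟩ := hf0.exists_pos
  obtain ⟨δ, hδ, hδf⟩ := Metric.eventually_nhds_iff.1 (eventually_nhdsWithin_iff.1 hCf.bound)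
  obtain ⟨M, hM⟩ := (isCompact_closedBall (0 : ℝ) r).exists_bound_of_continuousOn hf.continuousOn
  refine ⟨max C (M / δ ^ s), le_max_of_le_left hC.le, fun t ht => ?_⟩
  rcases eq_or_ne t 0 with rfl | ht0
  · rw [hzero, norm_zero]
    positivity
  rcases lt_or_ge |t| δ with hlt | hge
  · have hle : ‖f t‖ ≤ C * ‖|t| ^ s‖ := hδf (by rwa [Real.dist_eq, sub_zero]) ht0
    rw [Real.norm_of_nonneg (by positivity : 0 ≤ |t| ^ s)] at hle
    exact hle.trans (mul_le_mul_of_nonneg_right (le_max_left _ _) (by positivity))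
  · have : 0 ≤ M := (norm_nonneg _).trans (hM t (mem_closedBall_zero_iff.2 ht))
    calc ‖f t‖ ≤ M := hM t (mem_closedBall_zero_iff.2 ht)
      _ = M / δ ^ s * δ ^ s := (div_mul_cancel₀ _ (by positivity)).symm
      _ ≤ max C (M / δ ^ s) * ‖t‖ ^ s := by
        gcongr
        exacts [le_max_right _ _, hge]

variable {N : ℕ} {α θ : ℝ} {f : ℝ → ℝ}

theorem hasDerivAt_primitive (hf : Continuous f) (t : ℝ) : HasDerivAt (primitive f) (f t) t :=
  intervalIntegral.integral_hasDerivAt_right (hf.intervalIntegrable 0 t)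
    (hf.stronglyMeasurableAtFilter _ _) hf.continuousAt

theorem primitive_zero (f : ℝ → ℝ) : primitive f 0 = 0 :=
  intervalIntegral.integral_same

/-- The nonlocal part `½ ∑ (R_α * F(v)) F(v)` of the energy. -/
def nonlocalEnergy (α : ℝ) (f : ℝ → ℝ) (v : (Fin N → ℤ) → ℝ) : ℝ :=
  1 / 2 * ∑' x, greenConv α (fun y => primitive f (v y)) x * primitive f (v x)

/-- The derivative `∑ (R_α * F(v)) f(v) w` of the nonlocal energy at `v` in the direction `w`. -/
def nonlocalForm (α : ℝ) (f : ℝ → ℝ) (v w : (Fin N → ℤ) → ℝ) : ℝ :=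
  ∑' x, greenConv α (fun y => primitive f (v y)) x * f (v x) * w x

/-- The bilinear form `∑ (R_α * a) b` on `ℓ^1`. -/
def greenForm (hα : 0 < α) (hαN : α < N) :
    lp (fun _ : Fin N → ℤ => ℝ) 1 →L[ℝ] lp (fun _ : Fin N → ℤ => ℝ) 1 →L[ℝ] ℝ :=
  kernelForm (R := ⟨green α (0 : Fin N → ℤ) 0, green_nonneg hα hαN 0 0⟩) (abs_green_le hα hαN)

theorem greenForm_apply (hα : 0 < α) (hαN : α < N) (a b : lp (fun _ : Fin N → ℤ => ℝ) 1) :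
    greenForm hα hαN a b = ∑' x, greenConv α a x * b x :=
  rfl

theorem nonlocalEnergy_zero (α : ℝ) (f : ℝ → ℝ) :
    nonlocalEnergy α f (0 : (Fin N → ℤ) → ℝ) = 0 := by
  simp [nonlocalEnergy, primitive_zero]

theorem greenConv_nonneg (hα : 0 < α) (hαN : α < N) {g : (Fin N → ℤ) → ℝ} (hg : ∀ x, 0 ≤ g x)
    (x : Fin N → ℤ) : 0 ≤ greenConv α g x :=
  tsum_nonneg fun y => mul_nonneg (green_nonneg hα hαN x y) (hg y)

theorem nonlocalForm_single_right (α : ℝ) (f : ℝ → ℝ) (u : (Fin N → ℤ) → ℝ) (x : Fin N → ℤ)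
    (s : ℝ) : nonlocalForm α f u (Pi.single x s) =
      greenConv α (fun y => primitive f (u y)) x * f (u x) * s := by
  rw [nonlocalForm, tsum_eq_single x fun y hy => by rw [Pi.single_eq_of_ne hy, mul_zero],
    Pi.single_eq_same]

theorem nonlocalForm_single_single (α : ℝ) (f : ℝ → ℝ) (x : Fin N → ℤ) (s : ℝ) :
    nonlocalForm α f (Pi.single x s) (Pi.single x s) =
      green α x x * primitive f s * (f s * s) := by
  rw [nonlocalForm_single_right, greenConv, tsum_eq_single x fun y hy => by
    rw [Pi.single_eq_of_ne hy, primitive_zero, mul_zero], Pi.single_eq_same, mul_assoc]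

/-- The condition `0 ≤ θ F(t) ≤ 2 f(t) t` of Ambrosetti and Rabinowitz. -/
def AmbrosettiRabinowitz (θ : ℝ) (f : ℝ → ℝ) : Prop :=
  ∀ t, 0 ≤ θ * primitive f t ∧ θ * primitive f t ≤ 2 * f t * t

namespace AmbrosettiRabinowitz

theorem primitive_nonneg (hAR : AmbrosettiRabinowitz θ f) (hθ : 0 < θ) (t : ℝ) :
    0 ≤ primitive f t :=
  nonneg_of_mul_nonneg_right (hAR t).1 hθ

theorem apply_mul_self_nonneg (hAR : AmbrosettiRabinowitz θ f) (t : ℝ) : 0 ≤ f t * t := by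
  linarith [(hAR t).1, (hAR t).2]

theorem nonlocalForm_smul_nonneg (hAR : AmbrosettiRabinowitz θ f) (hθ : 0 < θ) (hα : 0 < α)
    (hαN : α < N) (u : (Fin N → ℤ) → ℝ) {t : ℝ} (ht : 0 < t) : 0 ≤ nonlocalForm α f (t • u) u :=
  tsum_nonneg fun x => by
    have hfu : 0 ≤ f ((t • u) x) * u x := by
      refine nonneg_of_mul_nonneg_right ?_ ht
      simpa only [Pi.smul_apply, smul_eq_mul, mul_left_comm t] using
        hAR.apply_mul_self_nonneg (t * u x)
    rw [mul_assoc]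
    exact mul_nonneg (greenConv_nonneg hα hαN (fun y => hAR.primitive_nonneg hθ _) x) hfu

end AmbrosettiRabinowitz

section Lp

variable {P : ℝ≥0∞}

theorem PowerGrowth.primitive (hf : Continuous f) (hP : 1 ≤ P.toReal)
    (hfP : PowerGrowth f (P.toReal - 1)) :
    PowerGrowth (primitive f) (P.toReal / (1 : ℝ≥0∞).toReal) := by
  have := PowerGrowth.of_fderiv (sub_nonneg.2 hP) (primitive_zero f)
    (fun t => (hasDerivAt_primitive hf t).hasFDerivAt)
    (fun r => by simpa only [ContinuousLinearMap.norm_toSpanSingleton] using hfP r)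
  rwa [ENNReal.toReal_one, div_one, ← sub_add_cancel P.toReal 1]

theorem PowerGrowth.mul_self (hP : 1 ≤ P.toReal) (hfP : PowerGrowth f (P.toReal - 1)) :
    PowerGrowth (fun t => f t * t) (P.toReal / (1 : ℝ≥0∞).toReal) := fun r => by
  obtain ⟨C, hC, hle⟩ := hfP r
  refine ⟨C, hC, fun t ht => ?_⟩
  have hpow : ‖t‖ ^ P.toReal = ‖t‖ ^ (P.toReal - 1) * ‖t‖ := by
    rw [← Real.rpow_add_one' (norm_nonneg t) (by linarith), sub_add_cancel]
  rw [ENNReal.toReal_one, div_one, norm_mul, hpow, ← mul_assoc]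
  exact mul_le_mul_of_nonneg_right (hle t ht) (norm_nonneg t)

theorem exists_hasStrictFDerivAt_nonlocalEnergy [Fact (1 ≤ P)] (hα : 0 < α) (hαN : α < N)
    (hf : Continuous f) (hP : 1 < P.toReal) (hfP : PowerGrowth f (P.toReal - 1))
    (u : lp (fun _ : Fin N → ℤ => ℝ) P) :
    ∃ D : lp (fun _ : Fin N → ℤ => ℝ) P →L[ℝ] ℝ,
      HasStrictFDerivAt (fun v : lp (fun _ : Fin N → ℤ => ℝ) P => nonlocalEnergy α f v) D u ∧
        ∀ w, D w = nonlocalForm α f u w := by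
  have hF := PowerGrowth.primitive hf hP.le hfP
  obtain ⟨D, hD, hDw⟩ := exists_hasStrictFDerivAt_superposition
    (fun t => (hasDerivAt_primitive hf t).hasFDerivAt)
    ((ContinuousLinearMap.toSpanSingletonCLE (𝕜 := ℝ) (E := ℝ)).continuous.comp hf) hP hF
    (fun r => by simpa only [ContinuousLinearMap.norm_toSpanSingleton] using hfP r) u
  have hB := ((greenForm hα hαN).hasStrictFDerivAt.comp u hD).clm_apply hD
  refine ⟨_, hB.const_mul (1 / 2), fun w => ?_⟩
  set Fu := superposition hF (zero_lt_one.trans hP) toReal_one_pos u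
  have hcomm : greenForm hα hαN (D w) Fu = greenForm hα hαN Fu (D w) :=
    kernelForm_comm _ (green_comm hα hαN) _ _
  change 1 / 2 * (greenForm hα hαN Fu (D w) + greenForm hα hαN (D w) Fu) = _
  rw [hcomm, ← two_mul, one_div, inv_mul_cancel_left₀ two_ne_zero, greenForm_apply]
  refine tsum_congr fun x => ?_
  rw [hDw, ContinuousLinearMap.toSpanSingleton_apply, smul_eq_mul, mul_comm (w x), ← mul_assoc]
  rfl

theorem AmbrosettiRabinowitz.mul_nonlocalEnergy_le (hAR : AmbrosettiRabinowitz θ f) (hθ : 0 < θ)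
    (hα : 0 < α) (hαN : α < N) (hf : Continuous f) (hP : 1 < P.toReal)
    (hfP : PowerGrowth f (P.toReal - 1)) (u : lp (fun _ : Fin N → ℤ => ℝ) P) :
    θ * nonlocalEnergy α f u ≤ nonlocalForm α f u u := by
  have hP0 := zero_lt_one.trans hP
  set Fu := superposition (.primitive hf hP.le hfP) hP0 toReal_one_pos u
  set fu := superposition (.mul_self hP.le hfP) hP0 toReal_one_pos u
  have hform : nonlocalForm α f u u = greenForm hα hαN Fu fu :=
    tsum_congr fun x => mul_assoc _ _ _
  have hle : greenForm hα hαN Fu ((θ / 2) • Fu) ≤ greenForm hα hαN Fu fu :=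
    kernelForm_mono_right _ (green_nonneg hα hαN) (fun x => hAR.primitive_nonneg hθ (u x))
      fun x => show θ / 2 * primitive f (u x) ≤ f (u x) * u x by linarith [(hAR (u x)).2]
  rw [map_smul, smul_eq_mul] at hle
  calc θ * (1 / 2 * greenForm hα hαN Fu Fu) = θ / 2 * greenForm hα hαN Fu Fu := by ring
    _ ≤ _ := hle.trans_eq hform.symm

theorem AmbrosettiRabinowitz.nonlocalEnergy_pos (hAR : AmbrosettiRabinowitz θ f) (hθ : 0 < θ)
    (hα : 0 < α) (hαN : α < N) (hf : Continuous f) (hP : 1 ≤ P.toReal)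
    (hfP : PowerGrowth f (P.toReal - 1)) {u : lp (fun _ : Fin N → ℤ => ℝ) P} {x : Fin N → ℤ}
    (hx : 0 < green α x x * primitive f (u x)) : 0 < nonlocalEnergy α f u := by
  have hF := fun t => hAR.primitive_nonneg hθ t
  have hFx : 0 < primitive f (u x) := pos_of_mul_pos_right hx (green_nonneg hα hαN x x)
  set Fu := superposition (.primitive hf hP hfP) (zero_lt_one.trans_le hP) toReal_one_pos u
  have hdiag : green α x x * primitive f (u x) * primitive f (u x) ≤ greenForm hα hαN Fu Fu :=
    diag_le_kernelForm (a := Fu) (b := Fu) _ (green_nonneg hα hαN) (fun y => hF (u y))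
      (fun y => hF (u y)) x
  exact mul_pos one_half_pos ((mul_pos hx hFx).trans_le hdiag)

end Lp

end Nonlocal

/-! ### Existence of ground states -/

section GroundState

open scoped ENNReal

variable {N : ℕ} {p α θ : ℝ} {f : ℝ → ℝ} {h : (Fin N → ℤ) → ℝ} {hp : 2 ≤ p} {hh : BoundedBelow h}

theorem hasFDerivAt_norm_rpow_ray {E : Type*} [NormedAddCommGroup E] [NormedSpace ℝ E] {u : E}
    {t : ℝ} (ht : 0 < t) {D : E →L[ℝ] ℝ} (hD : HasFDerivAt (fun w => ‖w‖ ^ p) D (t • u)) :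
    D u = p * (t ^ (p - 1) * ‖u‖ ^ p) := by
  have hray := hD.comp_hasDerivAt t ((hasDerivAt_id' t).smul_const u)
  have hpow := (Real.hasDerivAt_rpow_const (p := p) (.inl ht.ne')).mul_const (‖u‖ ^ p)
  rw [one_smul] at hray
  rw [← mul_assoc]
  refine hray.unique (hpow.congr_of_eventuallyEq ?_)
  filter_upwards [eventually_gt_nhds ht] with s hs
  rw [Function.comp_apply, norm_smul, Real.norm_of_nonneg hs.le,
    Real.mul_rpow hs.le (norm_nonneg u)]

theorem pos_of_strictMonoOn_div_rpow {g : ℝ → ℝ} {s : ℝ} (hg : ∀ t > 0, 0 ≤ g t)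
    (hmono : StrictMonoOn (fun t => g t / t ^ s) (Ioi 0)) {t : ℝ} (ht : 0 < t) : 0 < g t := by
  have hlt := hmono (mem_Ioi.2 (half_pos ht)) (mem_Ioi.2 ht) (half_lt_self ht)
  have hhalf : 0 ≤ g (t / 2) / (t / 2) ^ s := div_nonneg (hg _ (half_pos ht)) (by positivity)
  exact (div_pos_iff_of_pos_right (Real.rpow_pos_of_pos ht s)).1 (hhalf.trans_lt hlt)

theorem strictMonoOn_div_rpow_sub_one {g : ℝ → ℝ} {s : ℝ} (hg : ∀ t > 0, 0 ≤ g t)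
    (hmono : StrictMonoOn (fun t => g t / t ^ s) (Ioi 0)) :
    StrictMonoOn (fun t => g t / t ^ (s - 1)) (Ioi 0) := by
  have hmul : ∀ t ∈ Ioi (0 : ℝ), g t / t ^ (s - 1) = g t / t ^ s * t := fun t ht => by
    rw [Real.rpow_sub_one (ne_of_gt ht), div_div_eq_mul_div, mul_div_right_comm]
  intro a ha b hb hab
  have : 0 < a := ha
  beta_reduce
  rw [hmul a ha, hmul b hb]
  exact mul_lt_mul'' (hmono ha hb hab) hab (div_nonneg (hg a ha) (by positivity)) this.le

theorem gradForm_single_self (u : (Fin N → ℤ) → ℝ) (x : Fin N → ℤ) :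
    gradForm u (Pi.single x 1) x =
      -(1 / 2 * ∑ y ∈ (latticeGraph N).neighborFinset x, (u y - u x)) := by
  rw [gradForm, ← mul_neg, ← Finset.sum_neg_distrib]
  congr 1
  refine Finset.sum_congr rfl fun y hy => ?_
  rw [Pi.single_eq_same, Pi.single_eq_of_ne ((SimpleGraph.mem_neighborFinset _ _ _).1 hy).ne']
  ring

theorem gradForm_single_of_adj (u : (Fin N → ℤ) → ℝ) {x y : Fin N → ℤ}
    (hxy : (latticeGraph N).Adj x y) :
    gradForm u (Pi.single x 1) y = -(1 / 2 * (u y - u x)) := by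
  rw [gradForm, Finset.sum_eq_single_of_mem x ((SimpleGraph.mem_neighborFinset _ _ _).2 hxy.symm)
    fun z _ hz => by rw [Pi.single_eq_of_ne hz, Pi.single_eq_of_ne hxy.ne']; ring,
    Pi.single_eq_same, Pi.single_eq_of_ne hxy.ne']
  ring

theorem gradForm_single_of_not_adj (u : (Fin N → ℤ) → ℝ) {x y : Fin N → ℤ} (hne : y ≠ x)
    (hxy : ¬(latticeGraph N).Adj x y) : gradForm u (Pi.single x 1) y = 0 := by
  rw [gradForm, Finset.sum_eq_zero fun z hz => ?_, mul_zero]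
  have hzx : z ≠ x := by
    rintro rfl
    exact hxy ((SimpleGraph.mem_neighborFinset _ _ _).1 hz).symm
  rw [Pi.single_eq_of_ne hzx, Pi.single_eq_of_ne hne]
  ring

theorem tsum_gradForm_single (p : ℝ) (u : (Fin N → ℤ) → ℝ) (x : Fin N → ℤ) :
    ∑' y, gradLen u y ^ (p - 2) * gradForm u (Pi.single x 1) y = -pLaplacian p u x := by
  have hx : x ∉ (latticeGraph N).neighborFinset x := by simp
  have hnb : ∑ y ∈ (latticeGraph N).neighborFinset x,
      gradLen u y ^ (p - 2) * gradForm u (Pi.single x 1) y =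
      ∑ y ∈ (latticeGraph N).neighborFinset x,
        gradLen u y ^ (p - 2) * -(1 / 2 * (u y - u x)) :=
    Finset.sum_congr rfl fun y hy => by
      rw [gradForm_single_of_adj u ((SimpleGraph.mem_neighborFinset _ _ _).1 hy)]
  rw [tsum_eq_sum (s := insert x ((latticeGraph N).neighborFinset x)), Finset.sum_insert hx,
    gradForm_single_self, pLaplacian, hnb]
  · simp only [Finset.mul_sum, ← Finset.sum_neg_distrib, ← Finset.sum_add_distrib]
    exact Finset.sum_congr rfl fun y _ => by ring
  · intro y hy
    rw [Finset.mem_insert, SimpleGraph.mem_neighborFinset, not_or] at hy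
    rw [gradForm_single_of_not_adj u hy.1 hy.2, mul_zero]

theorem dirichletForm_single (p : ℝ) (h u : (Fin N → ℤ) → ℝ) (x : Fin N → ℤ) :
    dirichletForm p h u (Pi.single x 1) = -pLaplacian p u x + h x * |u x| ^ (p - 2) * u x := by
  rw [dirichletForm, tsum_gradForm_single,
    tsum_eq_single x fun y hy => by rw [Pi.single_eq_of_ne hy, mul_zero],
    Pi.single_eq_same, mul_one]

namespace HSpace

/-- The function equal to `s` at `x` and to `0` elsewhere, as an element of `H`. -/
def single (hp : 2 ≤ p) (hh : BoundedBelow h) (x : Fin N → ℤ) (s : ℝ) : HSpace p h hp hh :=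
  ofSummable hp hh (Pi.single x s) <| summable_energyDensity_of_finite hp h <|
    (finite_singleton x).subset Pi.support_single_subset

theorem single_ne_zero (x : Fin N → ℤ) {s : ℝ} (hs : s ≠ 0) : single hp hh x s ≠ 0 := fun h0 => by
  have hx : (Pi.single x s : (Fin N → ℤ) → ℝ) x = 0 :=
    congrArg (fun u : HSpace p h hp hh => u x) h0
  exact hs (by rwa [Pi.single_eq_same] at hx)

theorem exists_apply_ne_zero {u : HSpace p h hp hh} (hu : u ≠ 0) : ∃ x, u x ≠ 0 :=
  Function.ne_iff.1 (Subtype.coe_ne_coe.2 hu)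

theorem energy_eq (u : HSpace p h hp hh) :
    energy α f u = 1 / p * ‖u‖ ^ p - nonlocalEnergy α f u := by
  rw [norm_rpow]
  rfl

/-- Point masses, tested in the monotonicity along rays, isolate the diagonal of the kernel. -/
theorem green_mul_primitive_pos (hAR : AmbrosettiRabinowitz θ f) (hθ : 0 < θ) (hα : 0 < α)
    (hαN : α < N) (hray : ∀ u : HSpace p h hp hh, u ≠ 0 →
      StrictMonoOn (fun t : ℝ => nonlocalForm α f (t • u) u / t ^ (p - 1)) (Ioi 0))
    (x : Fin N → ℤ) {s : ℝ} (hs : s ≠ 0) : 0 < green α x x * primitive f s := by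
  have hpos : 0 < nonlocalForm α f ((1 : ℝ) • single hp hh x s) (single hp hh x s) :=
    pos_of_strictMonoOn_div_rpow (fun t ht => hAR.nonlocalForm_smul_nonneg hθ hα hαN _ ht)
      (hray _ (single_ne_zero x hs)) one_pos
  rw [one_smul] at hpos
  exact pos_of_mul_pos_left ((nonlocalForm_single_single α f x s).symm ▸ hpos)
    (hAR.apply_mul_self_nonneg s)

variable [Fact (1 ≤ ENNReal.ofReal p)]

theorem exists_hasStrictFDerivAt_nonlocalEnergy (hα : 0 < α) (hαN : α < N) (hf : Continuous f)
    (hfp : PowerGrowth f (p - 1)) (u : HSpace p h hp hh) :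
    ∃ D : HSpace p h hp hh →L[ℝ] ℝ,
      HasStrictFDerivAt (fun v : HSpace p h hp hh => nonlocalEnergy α f v) D u ∧
        ∀ w, D w = nonlocalForm α f u w := by
  rw [← toReal_ofReal hp] at hfp
  obtain ⟨D, hD, hDw⟩ := LatticeChoquard.exists_hasStrictFDerivAt_nonlocalEnergy hα hαN hf
    (by rw [toReal_ofReal hp]; linarith) hfp (toLp u)
  exact ⟨D ∘L toLp, hD.comp u toLp.hasStrictFDerivAt, fun w => hDw (toLp w)⟩

theorem exists_hasStrictFDerivAt_energy (hα : 0 < α) (hαN : α < N) (hf : Continuous f)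
    (hfp : PowerGrowth f (p - 1)) (u : HSpace p h hp hh) :
    ∃ D : HSpace p h hp hh →L[ℝ] ℝ, HasStrictFDerivAt (energy α f) D u ∧
      ∀ w, D w = dirichletForm p h u w - nonlocalForm α f u w := by
  have hp0 : p ≠ 0 := by linarith
  obtain ⟨D, hD, hDw⟩ := exists_hasStrictFDerivAt_norm_rpow u
  obtain ⟨D', hD', hD'w⟩ := exists_hasStrictFDerivAt_nonlocalEnergy hα hαN hf hfp u
  refine ⟨(1 / p) • D - D', ?_, fun w => ?_⟩
  · rw [funext energy_eq]
    exact (hD.const_mul (1 / p)).sub hD'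
  · change 1 / p * D w - D' w = _
    rw [hDw, hD'w, one_div, inv_mul_cancel_left₀ hp0]

theorem dirichletForm_smul_self (u : HSpace p h hp hh) {t : ℝ} (ht : 0 < t) :
    dirichletForm p h (t • u : HSpace p h hp hh) u = t ^ (p - 1) * ‖u‖ ^ p := by
  obtain ⟨D, hD, hDw⟩ := exists_hasStrictFDerivAt_norm_rpow (t • u)
  have hp0 : p ≠ 0 := by linarith
  exact mul_left_cancel₀ hp0 ((hDw u).symm.trans (hasFDerivAt_norm_rpow_ray ht hD.hasFDerivAt))

theorem hasStrictFDerivAt_energy (hα : 0 < α) (hαN : α < N) (hf : Continuous f)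
    (hfp : PowerGrowth f (p - 1)) (u : HSpace p h hp hh) :
    HasStrictFDerivAt (energy α f) (fderiv ℝ (energy α f) u) u := by
  obtain ⟨D, hD, -⟩ := exists_hasStrictFDerivAt_energy hα hαN hf hfp u
  rwa [hD.hasFDerivAt.fderiv]

theorem fderiv_energy_apply (hα : 0 < α) (hαN : α < N) (hf : Continuous f)
    (hfp : PowerGrowth f (p - 1)) (u w : HSpace p h hp hh) :
    fderiv ℝ (energy α f) u w = dirichletForm p h u w - nonlocalForm α f u w := by
  obtain ⟨D, hD, hDw⟩ := exists_hasStrictFDerivAt_energy hα hαN hf hfp u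
  rw [hD.hasFDerivAt.fderiv, hDw]

theorem raysCrossDownward_energy (hα : 0 < α) (hαN : α < N) (hf : Continuous f)
    (hfp : PowerGrowth f (p - 1)) (hray : ∀ u : HSpace p h hp hh, u ≠ 0 →
      StrictMonoOn (fun t : ℝ => nonlocalForm α f (t • u) u / t ^ (p - 1)) (Ioi 0)) :
    RaysCrossDownward (energy α f : HSpace p h hp hh → ℝ) :=
  .of_strictAntiOn (s := p - 1) fun u hu => by
    have hquot : ∀ t ∈ Ioi (0 : ℝ), fderiv ℝ (energy α f) (t • u) u / t ^ (p - 1) =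
        ‖u‖ ^ p - nonlocalForm α f (t • u) u / t ^ (p - 1) := fun t ht => by
      rw [fderiv_energy_apply hα hαN hf hfp, dirichletForm_smul_self u ht, sub_div,
        mul_div_cancel_left₀ _ (Real.rpow_pos_of_pos ht _).ne']
    intro a ha b hb hab
    beta_reduce
    rw [hquot a ha, hquot b hb]
    exact sub_lt_sub_left (hray u hu ha hb hab) _

theorem exists_smul_mem_nehari (hα : 0 < α) (hαN : α < N) (hf : Continuous f)
    (hfp : PowerGrowth f (p - 1)) (hAR : AmbrosettiRabinowitz θ f) (hpθ : p < θ)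
    (hray : ∀ u : HSpace p h hp hh, u ≠ 0 →
      StrictMonoOn (fun t : ℝ => nonlocalForm α f (t • u) u / t ^ (p - 1)) (Ioi 0))
    {u : HSpace p h hp hh} (hu : u ≠ 0) : ∃ t : ℝ, 0 < t ∧ t • u ∈ nehariSet (energy α f) := by
  have hp0 : 0 < p := by linarith
  have hP : 1 < (ENNReal.ofReal p).toReal := by rw [toReal_ofReal hp]; linarith
  have hfP : PowerGrowth f ((ENNReal.ofReal p).toReal - 1) := by rwa [toReal_ofReal hp]
  have hI := exists_hasStrictFDerivAt_nonlocalEnergy (h := h) (hp := hp) (hh := hh) hα hαN hf hfp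
  refine exists_pos_smul_mem_nehariSet hp0 hpθ (fun u => ?_)
    (fun u => (hasStrictFDerivAt_energy hα hαN hf hfp u).differentiableAt) energy_eq
    (nonlocalEnergy_zero α f) (fun u hu => ?_) (fun u => ?_) hu
  · exact (hI u).choose_spec.1.differentiableAt
  · obtain ⟨x, hx⟩ := exists_apply_ne_zero hu
    exact hAR.nonlocalEnergy_pos (hp0.trans hpθ) hα hαN hf hP.le hfP (u := toLp u)
      (green_mul_primitive_pos hAR (hp0.trans hpθ) hα hαN hray x hx)
  · obtain ⟨D, hD, hDw⟩ := hI u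
    rw [hD.hasFDerivAt.fderiv, hDw]
    exact hAR.mul_nonlocalEnergy_le (hp0.trans hpθ) hα hαN hf hP hfP (toLp u)

theorem exists_forall_energy_le (hα : 0 < α) (hαN : α < N) (hf : Continuous f)
    (hfp : PowerGrowth f (p - 1)) (hAR : AmbrosettiRabinowitz θ f) (hpθ : p < θ)
    (hray : ∀ u : HSpace p h hp hh, u ≠ 0 →
      StrictMonoOn (fun t : ℝ => nonlocalForm α f (t • u) u / t ^ (p - 1)) (Ioi 0))
    (hh_coercive : Tendsto h cofinite atTop) :
    ∃ u ∈ (nehariSet (energy α f) : Set (HSpace p h hp hh)),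
      ∀ v ∈ (nehariSet (energy α f) : Set (HSpace p h hp hh)), energy α f u ≤ energy α f v := by
  have hp0 : 0 < p := by linarith
  have hproj := fun u (hu : u ≠ 0) => exists_smul_mem_nehari hα hαN hf hfp hAR hpθ hray hu
  obtain ⟨t, -, ht⟩ := hproj (single hp hh 0 1) (single_ne_zero 0 one_ne_zero)
  have hΨ : Continuous fun v : lp (fun _ : Fin N → ℤ => ℝ) (ENNReal.ofReal p) =>
      nonlocalEnergy α f v := by
    rw [← toReal_ofReal hp] at hfp
    refine continuous_iff_continuousAt.2 fun v => ?_
    obtain ⟨D, hD, -⟩ := LatticeChoquard.exists_hasStrictFDerivAt_nonlocalEnergy hα hαN hf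
      (by rw [toReal_ofReal hp]; linarith) hfp v
    exact hD.hasFDerivAt.continuousAt
  exact (raysCrossDownward_energy hα hαN hf hfp hray).exists_forall_le
    (fun u => (hasStrictFDerivAt_energy hα hαN hf hfp u).differentiableAt) ⟨_, ht⟩ hproj
    (A := fun r => 1 / p * r ^ p)
    (fun a ha b _ hab => mul_le_mul_of_nonneg_left (Real.rpow_le_rpow ha hab hp0.le)
      (by positivity))
    ((tendsto_rpow_atTop hp0).const_mul_atTop (by positivity)) hΨ
    (isCompact_toLp_closedBall hh_coercive) energy_eq

theorem solvesEquation_of_fderiv_eq_zero (hα : 0 < α) (hαN : α < N) (hf : Continuous f)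
    (hfp : PowerGrowth f (p - 1)) {u : HSpace p h hp hh} (hu : fderiv ℝ (energy α f) u = 0) :
    SolvesEquation p α h f u := fun x => by
  have hx := fderiv_energy_apply hα hαN hf hfp u (single hp hh x 1)
  rw [hu, _root_.zero_apply] at hx
  refine (dirichletForm_single p h u x).symm.trans ((sub_eq_zero.1 hx.symm).trans ?_)
  exact (nonlocalForm_single_right α f u x 1).trans (mul_one _)

end HSpace

end GroundState

end LatticeChoquard

end

theorem theorem1p2_general {N : ℕ} {p α θ : ℝ} (hp : 2 ≤ p) (hα : 0 < α) (hαN : α < N)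
    {h : (Fin N → ℤ) → ℝ} {f : ℝ → ℝ} (hh : LatticeChoquard.BoundedBelow h)
    (hh_coercive : Filter.Tendsto h Filter.cofinite Filter.atTop) (hf : Continuous f)
    (hf_zero : f =O[nhdsWithin 0 {0}ᶜ] fun t : ℝ => |t| ^ (p - 1)) (hpθ : p < θ)
    (hAR : LatticeChoquard.AmbrosettiRabinowitz θ f)
    (hray : ∀ u : LatticeChoquard.HSpace p h hp hh, u ≠ 0 →
      StrictMonoOn (fun t : ℝ => LatticeChoquard.nonlocalForm α f (t • u) u / t ^ (p - 1))
        (Set.Ioi 0)) :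
    ∃ u : LatticeChoquard.HSpace p h hp hh,
      LatticeChoquard.IsGroundState α f u ∧ LatticeChoquard.SolvesEquation p α h f u := by
  have : Fact (1 ≤ ENNReal.ofReal p) := ⟨ENNReal.one_le_ofReal.2 (by linarith)⟩
  have hfp := LatticeChoquard.PowerGrowth.of_isBigO hf (by linarith) hf_zero
  have hdiff := LatticeChoquard.HSpace.hasStrictFDerivAt_energy (hp := hp) (hh := hh)
    hα hαN hf hfp
  obtain ⟨u, hu, hmin⟩ := LatticeChoquard.HSpace.exists_forall_energy_le
    hα hαN hf hfp hAR hpθ hray hh_coercive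
  have hcrit : fderiv ℝ (LatticeChoquard.energy α f) u = 0 :=
    (LatticeChoquard.HSpace.raysCrossDownward_energy hα hαN hf hfp hray).fderiv_eq_zero
      (fun v => (hdiff v).differentiableAt) (hdiff u) hu hmin
  refine ⟨u, ⟨hu.1, hcrit ▸ (hdiff u).hasFDerivAt, ?_⟩,
    LatticeChoquard.HSpace.solvesEquation_of_fderiv_eq_zero hα hαN hf hfp hcrit⟩
  exact IsLeast.isGLB ⟨Set.mem_image_of_mem _ hu, Set.forall_mem_image.2 hmin⟩

theorem theorem1p2 {N : ℕ} (p α : ℝ) (hp : 2 ≤ p) (hα₀ : 0 < α) (hαN : α < N)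
    (h : (Fin N → ℤ) → ℝ) (f : ℝ → ℝ)
    (h1 : LatticeChoquard.BoundedBelow h)
    (h3 : ∃ x₀ : Fin N → ℤ, Filter.Tendsto h
      (Filter.comap (fun x => (LatticeChoquard.latticeGraph N).dist x x₀) Filter.atTop)
      Filter.atTop)
    (f1_cont : Continuous f)
    (f1_zero : f =o[nhdsWithin 0 {0}ᶜ] fun t : ℝ => |t| ^ (p - 1))
    (f2 : ∃ C > (0 : ℝ), ∃ τ : ℝ, (N + α) * p / (2 * N) < τ ∧
      ∀ t : ℝ, |f t| ≤ C * (1 + |t| ^ (τ - 1)))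
    (f3 : ∃ θ : ℝ, p < θ ∧ ∀ t : ℝ, 0 ≤ θ * LatticeChoquard.primitive f t ∧
      θ * LatticeChoquard.primitive f t ≤ 2 * f t * t)
    (f4 : ∀ u : LatticeChoquard.HSpace p h hp h1, u ≠ 0 →
      StrictMonoOn (fun t : ℝ =>
        (∑' x, LatticeChoquard.greenConv α
          (fun y => LatticeChoquard.primitive f (t * u y)) x * f (t * u x) * u x) / t ^ p)
        (Set.Ioi 0)) :
    ∃ u : LatticeChoquard.HSpace p h hp h1,
      LatticeChoquard.IsGroundState α f u ∧ LatticeChoquard.SolvesEquation p α h f u := by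
  obtain ⟨θ, hpθ, hAR⟩ := f3
  obtain ⟨x₀, hx₀⟩ := h3
  refine theorem1p2_general hp hα₀ hαN h1
    (hx₀.comp (Filter.tendsto_comap_iff.2 (LatticeChoquard.tendsto_dist_cofinite x₀)))
    f1_cont f1_zero.isBigO hpθ hAR fun u hu =>
      LatticeChoquard.strictMonoOn_div_rpow_sub_one (fun t ht => ?_) (f4 u hu)
  exact LatticeChoquard.AmbrosettiRabinowitz.nonlocalForm_smul_nonneg hAR (by linarith) hα₀ hαN u ht
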